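/- **Setting.** Let $N\ge 3$ and let $P=\bigoplus_{i\in\mathbb Z/N}\mathbb Z\epsilon_i$ with $(\epsilon_i,\epsilon_j)=\delta_{ij}$; for $i\in\mathbb Z$ let $\epsilon_i$ denote the vector indexed by $i$ mod $N$. Let $Q\subset P$ be the sublattice spanned by all $\epsilon_i-\epsilon_j$, and let $\varepsilon:Q\times Q\to\{\pm1\}$ be bimultiplicative with $\varepsilon(\alpha,\alpha)=(-1)^{(\alpha,\alpha)/2}$. Let $q,p$ be nonzero complex numbers, $q$ not a root of unity, with fixed square roots $q^{1/2},p^{1/2}$ (arbitrarily chosen). Let $S=\mathbb C[\epsilon_i(-n): i\in\mathbb Z/N,\ n\ge1]$. For $n\geq 1$ let $\epsilon_i(-n)$ act on $S$ by multiplication and $\epsilon_i(n)$ by $n\,\partial/\partial\epsilon_i(-n)$, and let $V_Q=S\otimes\mathbb C[Q]$. For $\alpha\in Q$, $\beta\in P$ and $\mu\in\mathbb C^\times$ put, on $\mathbb C[Q]$, $e_\alpha e^\gamma=\varepsilon(\alpha,\gamma)e^{\gamma+\alpha}$, $z^\alpha e^\gamma=z^{(\alpha,\gamma)}e^\gamma$,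 $\mu^\beta e^\gamma=\mu^{(\beta,\gamma)}e^\gamma$. For $i,j,r\in\mathbb Z$ with $i\not\equiv j \pmod N$, and $\alpha=\epsilon_i-\epsilon_j$, define the following formal series of operators on $V_Q$: $$X_{ij}(r,z)= {:}\exp\Big(-\sum_{n\ne0}\frac{\epsilon_i(n)-p^{-rn}q^{(i-j)|n|}\epsilon_j(n)}{n}z^{-n}\Big){:}\; e_{\alpha}\,z^{\alpha+\frac{(\alpha,\alpha)}2}\,p^{-r\epsilon_j-\frac{(\epsilon_j,\alpha)}2r},$$ where the colons mean that all $\epsilon_k(n)$ with $n<0$ stand to the left of all those with $n>0$, and $$u_{ij}(r,z)=q^{(j-i)\alpha}\exp\Big(\sum_{n\ge1}\frac{q^{(j-i)n}-q^{(i-j)n}}n\big(q^{\frac{j-i}2n}\epsilon_i(n)-p^{-nr}q^{\frac{i-j}2n}\epsilon_j(n)\big)z^{-n}\Big),$$ $$v_{ij}(r,z)=q^{(i-j)\alpha}\exp\Big(\sum_{n\ge1}\frac{q^{(i-j)n}-q^{(j-i)n}}n\big(q^{\frac{j-i}2n}\epsilon_i(-n)-p^{nr}q^{\frac{i-j}2n}\epsilon_j(-n)\big)z^{n}\Big).$$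 Let $\delta(x)=\sum_{n\in\mathbb Z}x^n$. **Proposition.** Let $i,j,r_1,r_2\in\mathbb Z$ with $i\not\equiv j\pmod N$ and $r_1+r_2=0$. Then, as formal series in $z_1^{\pm1},z_2^{\pm1}$ with coefficients in $\operatorname{End}V_Q$, $$[X_{ij}(r_1,z_1),X_{ji}(r_2,z_2)]=\frac1{q^{j-i}-q^{i-j}}\Big(v_{ij}(r_1,q^{\frac{j-i}2}z_1)\,\delta\Big(\frac{q^{j-i}p^{r_1}z_1}{z_2}\Big)-u_{ij}(r_1,q^{\frac{j-i}2}p^{r_2}z_2)\,\delta\Big(\frac{q^{j-i}p^{r_2}z_2}{z_1}\Big)\Big).$$ -/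

import Mathlib

namespace QVertex

noncomputable section

/-! ### Lattices -/

/-- The lattice `P = ⊕ ℤ ε_i`. The index set is `ZMod N`, so that `ε_{i+N} = ε_i`. -/
abbrev P (N : ℕ) : Type := ZMod N → ℤ

/-- The vector `ε_i`, for `i ∈ ℤ`. -/
def eps (N : ℕ) (i : ℤ) : P N := Pi.single (i : ZMod N) 1

/-- The bilinear form on `P` with `(ε_i, ε_j) = δ_{ij}`. -/
def form {N : ℕ} [NeZero N] (x y : P N) : ℤ := ∑ k, x k * y k

/-- The root lattice `Q`, spanned by the differences `ε_i - ε_j`. -/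
def Q (N : ℕ) : AddSubgroup (P N) :=
  AddSubgroup.closure {x | ∃ i j : ℤ, x = eps N i - eps N j}

/-- `ε_i - ε_j` as an element of `Q`. -/
def root (N : ℕ) (i j : ℤ) : Q N :=
  ⟨eps N i - eps N j, AddSubgroup.subset_closure ⟨i, j, rfl⟩⟩

/-- Bimultiplicative functions `ε : Q × Q → {±1}` with `ε(α, α) = (-1)^{(α, α) / 2}`
(the lattice `Q` is even, so the division is exact). -/
structure IsCocycle {N : ℕ} [NeZero N] (ε : Q N → Q N → ℤˣ) : Prop where
  add_left : ∀ α β γ, ε (α + β) γ = ε α γ * ε β γ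
  add_right : ∀ α β γ, ε α (β + γ) = ε α β * ε α γ
  self : ∀ α : Q N, ε α α = Int.negOnePow (form (α : P N) α / 2)

/-! ### Fock space -/

/-- `S(H⁻)`: polynomials in the variables `ε_i(-n)`, `i ∈ ℤ/N`, `n ≥ 1`;
the variable with index `(i, n)` is `ε_i(-n)`. -/
abbrev S (N : ℕ) : Type := MvPolynomial (ZMod N × ℕ+) ℂ

/-- The action of the Heisenberg generators `ε_i(n)`, `n ≠ 0`, on `S(H⁻)` at level `C = 1`:
multiplication by the variable for `n < 0`, and `n ∂/∂ε_i(-n)` for `n > 0`, so that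
`[ε_i(m), ε_j(n)] = m δ_{ij} δ_{m+n,0}`. The value at `n = 0` is never used. -/
def heis (N : ℕ) (i : ℤ) : ℤ → Module.End ℂ (S N)
  | .ofNat 0 => 0
  | .ofNat (n + 1) =>
      ((n : ℂ) + 1) • (MvPolynomial.pderiv ((i : ZMod N), n.succPNat)).toLinearMap
  | .negSucc n => LinearMap.mulLeft ℂ (MvPolynomial.X ((i : ZMod N), n.succPNat))

/-- `V_Q = S(H⁻) ⊗ ℂ[Q]`, as finitely supported functions `Q → S(H⁻)`:
the vector `s ⊗ e^γ` is `Finsupp.single γ s`. -/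
abbrev V (N : ℕ) : Type := Q N →₀ S N

/-- The operator `s ⊗ e^γ ↦ (f γ) s ⊗ e^{γ + β}` on `V_Q`. -/
def gradedOp {N : ℕ} (β : Q N) (f : Q N → Module.End ℂ (S N)) : Module.End ℂ (V N) :=
  Finsupp.lsum ℂ fun γ => Finsupp.lsingle (γ + β) ∘ₗ f γ

/-! ### Formal series of operators -/

/-- `exp(A) = ∑_k A^k / k!` for a power series `A` without constant term, with coefficients in an
algebra over `ℂ` (as `A^k` starts in degree `k`, the terms with `k > n` do not contribute to the
coefficient of degree `n`). -/
def expSeries {R : Type*} [Ring R] [Algebra ℂ R] (A : PowerSeries R) : PowerSeries R :=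
  PowerSeries.mk fun n =>
    ∑ k ∈ Finset.range (n + 1), ((k.factorial : ℂ)⁻¹) • PowerSeries.coeff n (A ^ k)

/-- The sum of a family of operators of which, on every vector, only finitely many are nonzero. -/
def locSum {ι M : Type*} [AddCommGroup M] [Module ℂ M] (f : ι → Module.End ℂ M)
    (h : ∀ v, (Function.support fun b => f b v).Finite) : Module.End ℂ M where
  toFun v := ∑ᶠ b, f b v
  map_add' v w := by
    simp only [map_add]
    exact finsum_add_distrib (h v) (h w)
  map_smul' c v := by
    simp only [map_smul, RingHom.id_apply]
    exact (smul_finsum' c (h v)).symm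

/-! ### Vertex operators -/

/-- `(ε_i(n) - p^{-rn} q^{(i-j)|n|} ε_j(n)) / n`, for `n ≠ 0`. -/
def mode (N : ℕ) (q p : ℂ) (i j r n : ℤ) : Module.End ℂ (S N) :=
  (n : ℂ)⁻¹ • (heis N i n - (p ^ (-r * n) * q ^ ((i - j) * |n|)) • heis N j n)

/-- The creation part `exp(-∑_{n<0} mode(n) z^{-n})`, a power series in `z`. -/
def creation (N : ℕ) (q p : ℂ) (i j r : ℤ) : PowerSeries (Module.End ℂ (S N)) :=
  expSeries (PowerSeries.mk fun n => if n = 0 then 0 else -mode N q p i j r (-(n : ℤ)))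

/-- The annihilation part `exp(-∑_{n>0} mode(n) z^{-n})`, a power series in `z⁻¹`. -/
def annihilation (N : ℕ) (q p : ℂ) (i j r : ℤ) : PowerSeries (Module.End ℂ (S N)) :=
  expSeries (PowerSeries.mk fun n => if n = 0 then 0 else -mode N q p i j r (n : ℤ))

/-- The span of the monomials of weighted degree at most `d`, where `ε_i(-n)` has degree `n`. -/
def filt (N : ℕ) (d : ℤ) : Submodule ℂ (S N) :=
  Submodule.span ℂ {s | ∃ m : ZMod N × ℕ+ →₀ ℕ,
    ((m.sum fun x e => e * (x.2 : ℕ) : ℕ) : ℤ) ≤ d ∧ s = MvPolynomial.monomial m 1}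

theorem filt_mono (N : ℕ) {d e : ℤ} (h : d ≤ e) : filt N d ≤ filt N e := by
  refine Submodule.span_mono ?_
  rintro s ⟨m, hm, rfl⟩
  exact ⟨m, hm.trans h, rfl⟩

theorem filt_neg (N : ℕ) {d : ℤ} (h : d < 0) : filt N d = ⊥ := by
  rw [filt, Submodule.span_eq_bot]
  rintro s ⟨m, hm, -⟩
  exact absurd hm (by have := Int.natCast_nonneg (m.sum fun x e => e * (x.2 : ℕ)); omega)

theorem exists_mem_filt (N : ℕ) (s : S N) : ∃ d, s ∈ filt N d := by
  induction s using MvPolynomial.induction_on' with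
  | monomial m c =>
    have : MvPolynomial.monomial m c = c • (MvPolynomial.monomial m 1 : S N) := by
      rw [MvPolynomial.smul_monomial, smul_eq_mul, mul_one]
    rw [this]
    exact ⟨_, Submodule.smul_mem _ _ (Submodule.subset_span ⟨m, le_rfl, rfl⟩)⟩
  | add a b ha hb =>
    obtain ⟨d, hd⟩ := ha
    obtain ⟨e, he⟩ := hb
    exact ⟨max d e, Submodule.add_mem _ (filt_mono N (le_max_left d e) hd)
      (filt_mono N (le_max_right d e) he)⟩

theorem heis_mem_filt (N : ℕ) (i : ℤ) (n : ℕ) (d : ℤ) {s : S N} (hs : s ∈ filt N d) :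
    heis N i (n : ℤ) s ∈ filt N (d - n) := by
  cases n with
  | zero => exact Submodule.zero_mem _
  | succ n =>
    change ((n : ℂ) + 1) • (MvPolynomial.pderiv ((i : ZMod N), n.succPNat) s) ∈ _
    refine Submodule.smul_mem _ _ ?_
    induction hs using Submodule.span_induction with
    | zero => rw [map_zero]; exact Submodule.zero_mem _
    | add a b _ _ ha hb => rw [map_add]; exact Submodule.add_mem _ ha hb
    | smul c a _ ha => rw [Derivation.map_smul]; exact Submodule.smul_mem _ _ ha
    | mem a ha =>
      obtain ⟨m, hm, rfl⟩ := ha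
      rw [MvPolynomial.pderiv_monomial]
      set x : ZMod N × ℕ+ := ((i : ZMod N), n.succPNat) with hx
      by_cases h0 : m x = 0
      · simp [h0]
      · obtain ⟨m', rfl⟩ : ∃ m', m = m' + Finsupp.single x 1 :=
          ⟨m - Finsupp.single x 1, (tsub_add_cancel_of_le (by
            rw [Finsupp.single_le_iff]; omega)).symm⟩
        rw [add_tsub_cancel_right, ← mul_one (1 * _), ← smul_eq_mul _ (1 : ℂ),
          ← MvPolynomial.smul_monomial]
        refine Submodule.smul_mem _ _ (Submodule.subset_span ⟨m', ?_, rfl⟩)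
        rw [Finsupp.sum_add_index' (by simp) (by intros; ring),
          Finsupp.sum_single_index (by simp)] at hm
        have : (x.2 : ℕ) = n + 1 := rfl
        rw [this] at hm
        push_cast at hm ⊢
        linarith

theorem pow_mem_filt (N : ℕ) (A : PowerSeries (Module.End ℂ (S N)))
    (hA : ∀ (n : ℕ) (d : ℤ) (s : S N), s ∈ filt N d →
      PowerSeries.coeff n A s ∈ filt N (d - n))
    (k n : ℕ) (d : ℤ) {s : S N} (hs : s ∈ filt N d) :
    PowerSeries.coeff n (A ^ k) s ∈ filt N (d - n) := by
  induction k generalizing n d s with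
  | zero =>
    rw [pow_zero, PowerSeries.coeff_one]
    split_ifs with h
    · subst h; simpa using hs
    · exact Submodule.zero_mem _
  | succ k ih =>
    rw [pow_succ, PowerSeries.coeff_mul, LinearMap.sum_apply]
    refine Submodule.sum_mem _ fun x hx => ?_
    have h := ih x.1 _ (hA x.2 d s hs)
    have hx' : x.1 + x.2 = n := Finset.HasAntidiagonal.mem_antidiagonal.1 hx
    have e : d - (x.2 : ℤ) - (x.1 : ℤ) = d - n := by rw [← hx']; push_cast; ring
    rw [e] at h
    exact h

/-- On every vector only finitely many coefficients of the annihilation part are nonzero. -/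
theorem annihilation_finite (N : ℕ) (q p : ℂ) (i j r : ℤ) (s : S N) :
    ∃ B : ℕ, ∀ b, B ≤ b → PowerSeries.coeff b (annihilation N q p i j r) s = 0 := by
  obtain ⟨d, hd⟩ := exists_mem_filt N s
  refine ⟨(d + 1).toNat, fun b hb => ?_⟩
  rw [annihilation, expSeries, PowerSeries.coeff_mk, LinearMap.sum_apply]
  refine Finset.sum_eq_zero fun k _ => ?_
  rw [LinearMap.smul_apply]
  have h := pow_mem_filt N
    (PowerSeries.mk fun n => if n = 0 then 0 else -mode N q p i j r (n : ℤ))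
    (fun n e t ht => by
      rw [PowerSeries.coeff_mk]
      split_ifs
      · exact Submodule.zero_mem _
      · exact Submodule.neg_mem _ (Submodule.smul_mem _ _ (Submodule.sub_mem _
          (heis_mem_filt N i n e ht) (Submodule.smul_mem _ _ (heis_mem_filt N j n e ht)))))
    k b d hd
  rw [filt_neg N (by omega), Submodule.mem_bot] at h
  rw [h, smul_zero]

/-- The coefficient of `z^m` of the normally ordered exponential
`:exp(-∑_{n≠0} (ε_i(n) - p^{-rn} q^{(i-j)|n|} ε_j(n)) z^{-n} / n):`, that is, of
the product of the creation part (in `z`) with the annihilation part (in `z⁻¹`). -/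
def normalExp (N : ℕ) (q p : ℂ) (i j r m : ℤ) : Module.End ℂ (S N) :=
  locSum (fun b : ℕ => if 0 ≤ m + b then
      PowerSeries.coeff (m + b).toNat (creation N q p i j r) *
        PowerSeries.coeff b (annihilation N q p i j r) else 0)
    (fun s => by
      obtain ⟨B, hB⟩ := annihilation_finite N q p i j r s
      refine (Set.finite_lt_nat B).subset fun b hb => ?_
      by_contra hlt
      refine hb ?_
      dsimp only
      split_ifs
      · rw [Module.End.mul_apply, hB b (not_lt.1 hlt), map_zero]
      · rfl)

/-- The coefficient of `z^m` of the vertex operator `X_{ij}(r, z)`, where `α = ε_i - ε_j`: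
the normally ordered exponential times
`e_α z^{α + (α, α) / 2} p^{-r ε_j - (ε_j, α) r / 2}`.
Here `sp` is the chosen square root of `p`. On `e^γ`, the factor `z^{α + (α, α) / 2}` is
`z^{(α, γ) + (α, α) / 2}`, and `e_α e^γ = ε(α, γ) e^{γ + α}`. -/
def vertexX {N : ℕ} [NeZero N] (ε : Q N → Q N → ℤˣ) (q p sp : ℂ) (i j r m : ℤ) :
    Module.End ℂ (V N) :=
  gradedOp (root N i j) fun γ =>
    (((ε (root N i j) γ : ℤ) : ℂ) * p ^ (-r * form (eps N j) (γ : P N)) *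
        sp ^ (-form (eps N j) (root N i j : P N) * r)) •
      normalExp N q p i j r
        (m - (form (root N i j : P N) (γ : P N)
          + form (root N i j : P N) (root N i j : P N) / 2))

/-- The coefficient of `z^m` of
`u_{ij}(r, z) = q^{(j-i)(ε_i - ε_j)} exp(∑_{n≥1} (q^{(j-i)n} - q^{(i-j)n}) / n ·`
`(q^{(j-i)n/2} ε_i(n) - p^{-nr} q^{(i-j)n/2} ε_j(n)) z^{-n})`.
Here `sq` is the chosen square root of `q`. -/
def seriesU {N : ℕ} [NeZero N] (q p sq : ℂ) (i j r m : ℤ) : Module.End ℂ (V N) :=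
  if m ≤ 0 then
    gradedOp 0 fun γ => q ^ ((j - i) * form (root N i j : P N) (γ : P N)) •
      PowerSeries.coeff (-m).toNat (expSeries (PowerSeries.mk fun n : ℕ =>
        ((q ^ ((j - i) * n) - q ^ ((i - j) * n)) / (n : ℂ)) •
          (sq ^ ((j - i) * n) • heis N i (n : ℤ)
            - (p ^ (-(n : ℤ) * r) * sq ^ ((i - j) * n)) • heis N j (n : ℤ))))
  else 0

/-- The coefficient of `z^m` of
`v_{ij}(r, z) = q^{(i-j)(ε_i - ε_j)} exp(∑_{n≥1} (q^{(i-j)n} - q^{(j-i)n}) / n ·`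
`(q^{(j-i)n/2} ε_i(-n) - p^{nr} q^{(i-j)n/2} ε_j(-n)) z^n)`.
Here `sq` is the chosen square root of `q`. -/
def seriesV {N : ℕ} [NeZero N] (q p sq : ℂ) (i j r m : ℤ) : Module.End ℂ (V N) :=
  if 0 ≤ m then
    gradedOp 0 fun γ => q ^ ((i - j) * form (root N i j : P N) (γ : P N)) •
      PowerSeries.coeff m.toNat (expSeries (PowerSeries.mk fun n : ℕ =>
        ((q ^ ((i - j) * n) - q ^ ((j - i) * n)) / (n : ℂ)) •
          (sq ^ ((j - i) * n) • heis N i (-(n : ℤ))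
            - (p ^ ((n : ℤ) * r) * sq ^ ((i - j) * n)) • heis N j (-(n : ℤ)))))
  else 0

/-! ### Formal distributions

A formal distribution in `z` is given by its coefficients `f m` of `z^m`, `m ∈ ℤ`; one in
`z₁, z₂` by its coefficients `D a b` of `z₁^a z₂^b`. -/

/-- `f(c z)`. -/
def rescale {M : Type*} [AddCommGroup M] [Module ℂ M] (c : ℂ) (f : ℤ → M) (m : ℤ) : M :=
  c ^ m • f m

/-- `δ(c z₁ / z₂) = ∑_{n ∈ ℤ} c^n z₁^n z₂^{-n}`. -/
def deltaOneTwo (c : ℂ) (a b : ℤ) : ℂ := if b = -a then c ^ a else 0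

/-- `δ(c z₂ / z₁) = ∑_{n ∈ ℤ} c^n z₂^n z₁^{-n}`. -/
def deltaTwoOne (c : ℂ) (a b : ℤ) : ℂ := if a = -b then c ^ b else 0

/-- `f(z₁) D(z₁, z₂)`; for `D` a delta function as above each sum has at most one nonzero term. -/
def mulOne {M : Type*} [AddCommGroup M] [Module ℂ M] (f : ℤ → M) (D : ℤ → ℤ → ℂ) (a b : ℤ) : M :=
  ∑ᶠ k : ℤ, D (a - k) b • f k

/-- `f(z₂) D(z₁, z₂)`; for `D` a delta function as above each sum has at most one nonzero term. -/
def mulTwo {M : Type*} [AddCommGroup M] [Module ℂ M] (f : ℤ → M) (D : ℤ → ℤ → ℂ) (a b : ℤ) : M :=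
  ∑ᶠ k : ℤ, D a (b - k) • f k

/-- `[f(z₁), g(z₂)]`. -/
def commutator {M : Type*} [AddCommGroup M] [Module ℂ M] (f g : ℤ → Module.End ℂ M) (a b : ℤ) :
    Module.End ℂ M :=
  f a * g b - g b * f a

end

end QVertex

/-!
The proof is the standard operator product computation for vertex operators.

Write `t = q^{j-i}` and `P = p^{r₂} = p^{-r₁}`. Moving the annihilation part of one vertex operator
past the creation part of the other produces a scalar series: `e^A e^B = e^{[A, B]} e^B e^A`. For
`X_{ij}(r₁, z₁) X_{ji}(r₂, z₂)` the scalar is `1 / ((1 - t y)(1 - t⁻¹ y))` expanded in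
`y = P z₂ / z₁`, and for the opposite order it is the same rational function of `y⁻¹`. Together with
the zero modes, which contribute `-y^{1-a}` and `-y^{-1-a}` on `e^γ` with `a = (ε_i - ε_j, γ)`, the
commutator is the normally ordered product multiplied by `-y^{-a}` and by
`∑_{k ∈ ℤ} [k] y^k = (δ(t y) - δ(t⁻¹ y)) / (t - t⁻¹)`, where `[k] = (t^k - t^{-k}) / (t - t⁻¹)`.
On the support `t y = 1` of the first delta function the creation parts of the normally ordered
product cancel and the annihilation parts combine to `u`; on `t⁻¹ y = 1` the annihilation parts
cancel and the creation parts combine to `v`.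

The exponentials are power series over a noncommutative ring, so all identities between them are
derived from the uniqueness of solutions of `z Y' = B Y` (`euler_expSeries`, `eq_of_euler_eq_mul`).
The exchange relation is `expSeries_mul_C_coeff_expSeries`, the product of two normally ordered
series is `normalOrder_normalOrder`, the sum of a delta function against the normally ordered
product is `finsum_zpow_smul_normalOrderPair`, and `normalOrder_commutator` assembles these for
abstract creation and annihilation series. The rest identifies the data of the Fock space, and
compares the scalars.
-/

namespace QVertex

noncomputable section

open Finset.HasAntidiagonal (antidiagonal mem_antidiagonal)

/-! ### Exponentials of power series over a noncommutative ring -/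

theorem commute_of_coeff {R : Type*} [Ring R] {f g : PowerSeries R}
    (h : ∀ m n, Commute (PowerSeries.coeff m f) (PowerSeries.coeff n g)) : Commute f g := by
  ext n
  rw [PowerSeries.coeff_mul, PowerSeries.coeff_mul, ← Finset.Nat.sum_antidiagonal_swap]
  exact Finset.sum_congr rfl fun x _ => h _ _

theorem coeff_pow_eq_zero {R : Type*} [Ring R] {A : PowerSeries R}
    (h0 : PowerSeries.coeff 0 A = 0) {n k : ℕ} (hk : n < k) : PowerSeries.coeff n (A ^ k) = 0 := by
  induction k generalizing n with
  | zero => omega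
  | succ k ih =>
    rw [pow_succ, PowerSeries.coeff_mul]
    refine Finset.sum_eq_zero fun x hx => ?_
    have := mem_antidiagonal.1 hx
    rcases Nat.eq_zero_or_pos x.2 with h | h
    · rw [h, h0, mul_zero]
    · rw [ih (by omega), zero_mul]

section ExpSeries

variable {R : Type*} [Ring R] [Algebra ℂ R]

/-- The Euler operator `z d/dz`, multiplying the coefficient of `z^n` by `n`. It is defined by hand
because the coefficient ring need not be commutative. -/
def euler (f : PowerSeries R) : PowerSeries R :=
  PowerSeries.mk fun n => (n : ℂ) • PowerSeries.coeff n f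

@[simp] theorem coeff_euler (n : ℕ) (f : PowerSeries R) :
    PowerSeries.coeff n (euler f) = (n : ℂ) • PowerSeries.coeff n f :=
  PowerSeries.coeff_mk _ _

theorem coeff_smul' (n : ℕ) (c : ℂ) (f : PowerSeries R) :
    PowerSeries.coeff n (c • f) = c • PowerSeries.coeff n f := rfl

theorem euler_add (f g : PowerSeries R) : euler (f + g) = euler f + euler g := by
  ext n; simp

theorem euler_sub (f g : PowerSeries R) : euler (f - g) = euler f - euler g := by
  ext n; simp [smul_sub]

theorem euler_smul (c : ℂ) (f : PowerSeries R) : euler (c • f) = c • euler f := by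
  ext n; simp only [coeff_euler, coeff_smul']; rw [smul_comm]

theorem euler_sum {ι : Type*} (s : Finset ι) (f : ι → PowerSeries R) :
    euler (∑ i ∈ s, f i) = ∑ i ∈ s, euler (f i) := by
  ext n; simp [map_sum, Finset.smul_sum]

theorem euler_mul (f g : PowerSeries R) : euler (f * g) = euler f * g + f * euler g := by
  ext n
  simp only [coeff_euler, map_add, PowerSeries.coeff_mul, Finset.smul_sum,
    ← Finset.sum_add_distrib]
  refine Finset.sum_congr rfl fun x hx => ?_
  rw [← mem_antidiagonal.1 hx, smul_mul_assoc, mul_smul_comm, ← add_smul]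
  push_cast
  rfl

theorem euler_C (x : R) : euler (PowerSeries.C x) = 0 := by
  ext n
  rw [coeff_euler, PowerSeries.coeff_C]
  split_ifs with h
  · simp [h]
  · simp

theorem euler_X_pow (k : ℕ) :
    euler (PowerSeries.X ^ k : PowerSeries R) = (k : ℂ) • PowerSeries.X ^ k := by
  ext n
  rw [coeff_euler, coeff_smul', PowerSeries.coeff_X_pow]
  split_ifs with h
  · simp [h]
  · simp

theorem euler_pow {A : PowerSeries R} (h : Commute A (euler A)) (k : ℕ) :
    euler (A ^ (k + 1)) = ((k : ℂ) + 1) • (euler A * A ^ k) := by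
  induction k with
  | zero => simp
  | succ k ih =>
    rw [pow_succ, euler_mul, ih, smul_mul_assoc, mul_assoc, ← pow_succ,
      (h.pow_left (k + 1)).eq]
    push_cast
    module

/-- The defining sum of `expSeries` may be truncated at any order above the degree. -/
theorem coeff_expSeries {A : PowerSeries R} (h0 : PowerSeries.coeff 0 A = 0) {n m : ℕ}
    (h : n < m) : PowerSeries.coeff n (expSeries A) =
      ∑ k ∈ Finset.range m, ((k.factorial : ℂ)⁻¹) • PowerSeries.coeff n (A ^ k) := by
  rw [expSeries, PowerSeries.coeff_mk]
  refine Finset.sum_subset (Finset.range_mono h) fun k _ hk => ?_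
  rw [Finset.mem_range] at hk
  rw [coeff_pow_eq_zero h0 (by omega), smul_zero]

theorem coeff_zero_expSeries (A : PowerSeries R) : PowerSeries.coeff 0 (expSeries A) = 1 := by
  simp [expSeries]

theorem constantCoeff_expSeries (A : PowerSeries R) :
    PowerSeries.constantCoeff (expSeries A) = 1 := by
  rw [← PowerSeries.coeff_zero_eq_constantCoeff_apply, coeff_zero_expSeries]

/-- The differential equation `z (exp A)' = (z A') exp A`, for `A` with commuting coefficients. -/
theorem euler_expSeries {A : PowerSeries R} (h0 : PowerSeries.coeff 0 A = 0)
    (h : ∀ m n, Commute (PowerSeries.coeff m A) (PowerSeries.coeff n A)) :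
    euler (expSeries A) = euler A * expSeries A := by
  have hc : Commute A (euler A) := commute_of_coeff fun m n => by
    rw [coeff_euler]; exact (h m n).smul_right _
  ext n
  have e : ∀ x ∈ antidiagonal n,
      PowerSeries.coeff x.1 (euler A) * PowerSeries.coeff x.2 (expSeries A) =
      ∑ k ∈ Finset.range (n + 1), ((k.factorial : ℂ)⁻¹) •
        (PowerSeries.coeff x.1 (euler A) * PowerSeries.coeff x.2 (A ^ k)) := fun x hx => by
    have := mem_antidiagonal.1 hx
    rw [coeff_expSeries h0 (show x.2 < n + 1 by omega), Finset.mul_sum]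
    exact Finset.sum_congr rfl fun k _ => mul_smul_comm _ _ _
  rw [PowerSeries.coeff_mul, Finset.sum_congr rfl e, Finset.sum_comm, coeff_euler,
    coeff_expSeries h0 (show n < n + 1 + 1 by omega), Finset.sum_range_succ']
  have z : (n : ℂ) • (((Nat.factorial 0 : ℕ) : ℂ)⁻¹ • PowerSeries.coeff n (A ^ 0)) = 0 := by
    rw [pow_zero, PowerSeries.coeff_one]
    split_ifs with h
    · simp [h]
    · simp
  rw [smul_add, z, add_zero, Finset.smul_sum]
  refine Finset.sum_congr rfl fun k _ => ?_
  rw [← Finset.smul_sum, ← PowerSeries.coeff_mul, smul_comm, ← coeff_euler, euler_pow hc,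
    coeff_smul', smul_smul, Nat.factorial_succ]
  congr 1
  have : (k : ℂ) + 1 ≠ 0 := Nat.cast_add_one_ne_zero k
  push_cast
  field_simp

/-- A solution of `z Y' = B Y` with `B(0) = 0` is determined by its constant term. -/
theorem eq_of_euler_eq_mul {B Y Z : PowerSeries R} (hB : PowerSeries.coeff 0 B = 0)
    (hY : euler Y = B * Y) (hZ : euler Z = B * Z)
    (h : PowerSeries.coeff 0 Y = PowerSeries.coeff 0 Z) : Y = Z := by
  ext n
  induction n using Nat.strong_induction_on with
  | _ n ih =>
    rcases Nat.eq_zero_or_pos n with rfl | hn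
    · exact h
    · have e : (n : ℂ) • PowerSeries.coeff n Y = (n : ℂ) • PowerSeries.coeff n Z := by
        rw [← coeff_euler, ← coeff_euler, hY, hZ, PowerSeries.coeff_mul, PowerSeries.coeff_mul]
        refine Finset.sum_congr rfl fun x hx => ?_
        have := mem_antidiagonal.1 hx
        rcases Nat.eq_zero_or_pos x.1 with h1 | h1
        · rw [h1, hB, zero_mul, zero_mul]
        · rw [ih _ (by omega)]
      have hn' : (n : ℂ) ≠ 0 := by exact_mod_cast hn.ne'
      exact smul_right_injective R hn' e

theorem coeff_zero_euler (f : PowerSeries R) : PowerSeries.coeff 0 (euler f) = 0 := by simp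

/-- If `[x, B] = β` is a scalar series, then `[x, exp B] = β exp B`. -/
theorem C_mul_expSeries {B : PowerSeries R} (h0 : PowerSeries.coeff 0 B = 0)
    (h : ∀ m n, Commute (PowerSeries.coeff m B) (PowerSeries.coeff n B)) {x : R} {b : ℕ → ℂ}
    (hb : b 0 = 0)
    (hx : ∀ n, x * PowerSeries.coeff n B = PowerSeries.coeff n B * x + b n • 1) :
    PowerSeries.C x * expSeries B = expSeries B * PowerSeries.C x
      + (PowerSeries.mk fun n => b n • (1 : R)) * expSeries B := by
  set β : PowerSeries R := PowerSeries.mk fun n => b n • (1 : R) with hβ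
  have hE := euler_expSeries h0 h
  have hβc : ∀ f : PowerSeries R, β * f = f * β := fun f => commute_of_coeff fun m n => by
    rw [hβ, PowerSeries.coeff_mk]
    exact (Commute.one_left _).smul_left _
  -- `x` acts on `B` as a derivation, and `β` is central, so the difference of the two sides solves
  -- the equation of `exp B` with constant term zero.
  have hxB : PowerSeries.C x * euler B = euler B * PowerSeries.C x + euler β := by
    ext n
    rw [map_add, PowerSeries.coeff_C_mul, PowerSeries.coeff_mul_C, coeff_euler, coeff_euler,
      mul_smul_comm, hx, hβ, PowerSeries.coeff_mk, smul_mul_assoc, smul_add]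
  rw [← sub_eq_zero, ← sub_sub]
  refine eq_of_euler_eq_mul (coeff_zero_euler B) ?_ ?_ ?_
  · rw [euler_sub, euler_sub, euler_mul, euler_mul, euler_mul, euler_C, hE, zero_mul, mul_zero,
      zero_add, add_zero, ← mul_assoc, hxB, ← mul_assoc β, hβc (euler B)]
    noncomm_ring
  · ext n; simp
  · simp [constantCoeff_expSeries, hβ, hb]

theorem commute_coeff_expSeries {B : PowerSeries R} (h0 : PowerSeries.coeff 0 B = 0)
    (h : ∀ m n, Commute (PowerSeries.coeff m B) (PowerSeries.coeff n B)) {x : R}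
    (hx : ∀ n, Commute x (PowerSeries.coeff n B)) (n : ℕ) :
    Commute x (PowerSeries.coeff n (expSeries B)) := by
  have := C_mul_expSeries (b := 0) h0 h rfl (fun n => by simpa using (hx n).eq)
  have := congrArg (PowerSeries.coeff n) this
  have z : (PowerSeries.mk fun n => (0 : ℕ → ℂ) n • (1 : R)) = 0 := by ext; simp
  rw [z, zero_mul, add_zero, PowerSeries.coeff_C_mul, PowerSeries.coeff_mul_C] at this
  exact this

theorem expSeries_add {A B : PowerSeries R} (hA0 : PowerSeries.coeff 0 A = 0)
    (hB0 : PowerSeries.coeff 0 B = 0)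
    (hA : ∀ m n, Commute (PowerSeries.coeff m A) (PowerSeries.coeff n A))
    (hB : ∀ m n, Commute (PowerSeries.coeff m B) (PowerSeries.coeff n B))
    (hAB : ∀ m n, Commute (PowerSeries.coeff m A) (PowerSeries.coeff n B)) :
    expSeries (A + B) = expSeries A * expSeries B := by
  have h0 : PowerSeries.coeff 0 (A + B) = 0 := by rw [map_add, hA0, hB0, add_zero]
  have hc : expSeries A * euler B = euler B * expSeries A := commute_of_coeff fun m n => by
    rw [coeff_euler]
    exact (commute_coeff_expSeries hA0 hA (fun k => (hAB k n).symm) m).symm.smul_right _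
  refine eq_of_euler_eq_mul (coeff_zero_euler (A + B)) (euler_expSeries h0 fun m n => ?_) ?_ ?_
  · rw [map_add, map_add]
    exact ((hA m n).add_right (hAB m n)).add_left (((hAB n m).symm).add_right (hB m n))
  · rw [euler_mul, euler_expSeries hA0 hA, euler_expSeries hB0 hB, ← mul_assoc, hc, euler_add]
    noncomm_ring
  · simp [constantCoeff_expSeries]

theorem expSeries_zero : expSeries (0 : PowerSeries R) = 1 := by
  refine eq_of_euler_eq_mul (coeff_zero_euler (0 : PowerSeries R))
    (euler_expSeries (by simp) (by simp)) ?_ ?_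
  · ext n
    rw [mul_one, coeff_euler, coeff_euler, PowerSeries.coeff_one]
    split_ifs with h <;> simp [h]
  · simp [constantCoeff_expSeries]

/-- The substitution `f(c z)`, over a noncommutative coefficient ring. -/
def scale (c : ℂ) (f : PowerSeries R) : PowerSeries R :=
  PowerSeries.mk fun n => c ^ n • PowerSeries.coeff n f

@[simp] theorem coeff_scale (c : ℂ) (f : PowerSeries R) (n : ℕ) :
    PowerSeries.coeff n (scale c f) = c ^ n • PowerSeries.coeff n f :=
  PowerSeries.coeff_mk _ _

theorem scale_mul (c : ℂ) (f g : PowerSeries R) : scale c (f * g) = scale c f * scale c g := by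
  ext n
  simp only [coeff_scale, PowerSeries.coeff_mul, Finset.smul_sum]
  refine Finset.sum_congr rfl fun x hx => ?_
  rw [← mem_antidiagonal.1 hx, smul_mul_smul_comm, pow_add]

theorem euler_scale (c : ℂ) (f : PowerSeries R) : euler (scale c f) = scale c (euler f) := by
  ext n
  simp only [coeff_scale, coeff_euler]
  rw [smul_comm]

theorem expSeries_scale (c : ℂ) {A : PowerSeries R} (h0 : PowerSeries.coeff 0 A = 0)
    (h : ∀ m n, Commute (PowerSeries.coeff m A) (PowerSeries.coeff n A)) :
    expSeries (scale c A) = scale c (expSeries A) := by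
  refine eq_of_euler_eq_mul (coeff_zero_euler (scale c A))
    (euler_expSeries (by rw [coeff_scale, h0, smul_zero]) fun m n => ?_) ?_ ?_
  · rw [coeff_scale, coeff_scale]
    exact ((h m n).smul_right _).smul_left _
  · rw [euler_scale, euler_scale, ← scale_mul, euler_expSeries h0 h]
  · rw [coeff_scale, coeff_zero_expSeries, coeff_zero_expSeries, pow_zero, one_smul]

/-- The exchange relation `exp(A(w)) exp(B(z)) = f(w z) exp(B(z)) exp(A(w))` when
`[A(w), B(z)] = ∑ κ_n (w z)^n` is scalar and `f` is the exponential of this series, given by its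
coefficients through `z f' = (∑ n κ_n z^n) f`. The identity is stated for the coefficient of `z^l`,
as power series in `w`: there both sides solve the same differential equation. -/
theorem expSeries_mul_C_coeff_expSeries {A B : PowerSeries R} (hA0 : PowerSeries.coeff 0 A = 0)
    (hB0 : PowerSeries.coeff 0 B = 0)
    (hA : ∀ m n, Commute (PowerSeries.coeff m A) (PowerSeries.coeff n A))
    (hB : ∀ m n, Commute (PowerSeries.coeff m B) (PowerSeries.coeff n B))
    {κ f : ℕ → ℂ} (hκ : κ 0 = 0)
    (hAB : ∀ m n, PowerSeries.coeff m A * PowerSeries.coeff n B =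
      PowerSeries.coeff n B * PowerSeries.coeff m A + (if m = n then κ n else 0) • 1)
    (hf0 : f 0 = 1) (hf : ∀ m, m * f m = ∑ x ∈ antidiagonal m, f x.1 * (x.2 * κ x.2)) (l : ℕ) :
    expSeries A * PowerSeries.C (PowerSeries.coeff l (expSeries B)) =
      ∑ x ∈ antidiagonal l, f x.1 • (PowerSeries.X ^ x.1 *
        (PowerSeries.C (PowerSeries.coeff x.2 (expSeries B)) * expSeries A)) := by
  set E := expSeries A with hE
  set F : ℕ → PowerSeries R := fun l => PowerSeries.C (PowerSeries.coeff l (expSeries B)) with hF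
  have hEe : euler E = euler A * E := euler_expSeries hA0 hA
  have hX : ∀ (n : ℕ) (g : PowerSeries R), PowerSeries.X ^ n * g = g * PowerSeries.X ^ n :=
    fun n g => (PowerSeries.commute_X_pow g n).symm.eq
  -- Commuting `A` past one coefficient of `exp B`, by `C_mul_expSeries` in the other variable.
  have comm : ∀ l, euler A * F l = F l * euler A +
      ∑ x ∈ antidiagonal l, ((x.2 : ℂ) * κ x.2) • (PowerSeries.X ^ x.2 * F x.1) := by
    intro l
    ext n
    have h1 := congrArg (PowerSeries.coeff l) (C_mul_expSeries
      (b := fun m => if n = m then κ m else 0) hB0 hB (by simp [hκ]) (hAB n))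
    rw [PowerSeries.coeff_C_mul, map_add, PowerSeries.coeff_mul_C, PowerSeries.coeff_mul] at h1
    rw [map_add, hF, PowerSeries.coeff_C_mul, PowerSeries.coeff_mul_C, coeff_euler,
      smul_mul_assoc, h1, mul_smul_comm, smul_add, map_sum, Finset.smul_sum,
      ← Finset.Nat.sum_antidiagonal_swap]
    congr 1
    refine Finset.sum_congr rfl fun x _ => ?_
    simp only [Prod.fst_swap, Prod.snd_swap, PowerSeries.coeff_mk, coeff_smul']
    rw [PowerSeries.coeff_mul_C, PowerSeries.coeff_X_pow]
    split_ifs with h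
    · rw [smul_mul_assoc, smul_smul, h]
    · simp
  change E * F l = ∑ x ∈ antidiagonal l, f x.1 • (PowerSeries.X ^ x.1 * (F x.2 * E))
  refine eq_of_euler_eq_mul (coeff_zero_euler A) ?_ ?_ ?_
  · rw [euler_mul, hF, euler_C, mul_zero, add_zero, hEe, mul_assoc]
  · rw [euler_sum, Finset.mul_sum]
    have e1 : ∀ x : ℕ × ℕ, euler (f x.1 • (PowerSeries.X ^ x.1 * (F x.2 * E))) =
        (x.1 * f x.1) • (PowerSeries.X ^ x.1 * (F x.2 * E)) +
        f x.1 • (PowerSeries.X ^ x.1 * (F x.2 * (euler A * E))) := by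
      intro x
      rw [euler_smul, euler_mul, euler_mul, euler_X_pow, hF, euler_C, zero_mul, zero_add, hEe,
        smul_mul_assoc]
      module
    have e2 : ∀ x : ℕ × ℕ, euler A * f x.1 • (PowerSeries.X ^ x.1 * (F x.2 * E)) =
        (∑ y ∈ antidiagonal x.2, (f x.1 * (y.2 * κ y.2)) •
          (PowerSeries.X ^ (x.1 + y.2) * (F y.1 * E))) +
        f x.1 • (PowerSeries.X ^ x.1 * (F x.2 * (euler A * E))) := by
      intro x
      rw [mul_smul_comm, ← mul_assoc (euler A), ← hX, mul_assoc, ← mul_assoc (euler A), comm,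
        add_mul, mul_add, smul_add, add_comm, mul_assoc (F x.2), Finset.sum_mul, Finset.mul_sum,
        Finset.smul_sum]
      congr 1
      refine Finset.sum_congr rfl fun y _ => ?_
      rw [smul_mul_assoc, mul_smul_comm, smul_smul, pow_add]
      noncomm_ring
    simp_rw [e1, e2, Finset.sum_add_distrib]
    congr 1
    -- What remains is the recursion for `f`, after reindexing the triples of sum `l`.
    simp_rw [hf, Finset.sum_smul]
    rw [Finset.sum_sigma', Finset.sum_sigma']
    refine Finset.sum_nbij' (fun w => ⟨(w.2.1, w.1.2 + w.2.2), (w.1.2, w.2.2)⟩)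
      (fun w => ⟨(w.1.1 + w.2.2, w.2.1), (w.1.1, w.2.2)⟩) ?_ ?_ ?_ ?_ ?_
    · rintro ⟨⟨n, c⟩, ⟨a, d⟩⟩ h
      simp only [Finset.mem_sigma, mem_antidiagonal] at h ⊢
      exact ⟨by omega, trivial⟩
    · rintro ⟨⟨a, e⟩, ⟨c, d⟩⟩ h
      simp only [Finset.mem_sigma, mem_antidiagonal] at h ⊢
      exact ⟨by omega, trivial⟩
    · rintro ⟨⟨n, c⟩, ⟨a, d⟩⟩ h
      simp only [Finset.mem_sigma, mem_antidiagonal] at h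
      simp [h.2]
    · rintro ⟨⟨a, e⟩, ⟨c, d⟩⟩ h
      simp only [Finset.mem_sigma, mem_antidiagonal] at h
      simp [h.2]
    · rintro ⟨⟨n, c⟩, ⟨a, d⟩⟩ h
      simp only [Finset.mem_sigma, mem_antidiagonal] at h
      simp only [h.2]
  · rw [map_sum, Finset.sum_eq_single (0, l)]
    · simp [hF, hE, hf0, constantCoeff_expSeries]
    · rintro ⟨x, y⟩ hx hne
      have : x ≠ 0 := by
        rintro rfl
        have := mem_antidiagonal.1 hx
        simp_all
      rw [coeff_smul', PowerSeries.coeff_X_pow_mul', if_neg (by simpa using this), smul_zero]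
    · simp

end ExpSeries

/-! ### Normally ordered products -/

theorem finite_support_of_bounds {M : Type*} [AddCommGroup M] {g : ℤ → M} (a b : ℤ)
    (h : ∀ k, g k ≠ 0 → a ≤ k ∧ k ≤ b) :
    (Function.support g).Finite :=
  (Set.finite_Icc a b).subset fun k hk => h k hk

theorem finsum_int_eq_sum_range {M : Type*} [AddCommGroup M] {g : ℤ → M} (B : ℕ)
    (h : ∀ k, g k ≠ 0 → 0 ≤ k ∧ k < B) :
    ∑ᶠ k, g k = ∑ b ∈ Finset.range B, g b := by
  rw [finsum_eq_sum_of_support_subset (s := (Finset.range B).map Nat.castEmbedding)]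
  · simp
  · intro k hk
    obtain ⟨h0, hB⟩ := h k hk
    simp only [Finset.coe_map, Set.mem_image, Finset.mem_coe, Finset.mem_range]
    exact ⟨k.toNat, by omega, by simp [h0]⟩

section NormalOrder

variable {M : Type*} [AddCommGroup M] [Module ℂ M]

/-- The coefficient of `z^m` of a power series, extended by zero to `m < 0`. -/
def zcoeff {R : Type*} [Ring R] (f : PowerSeries R) (m : ℤ) : R :=
  if 0 ≤ m then PowerSeries.coeff m.toNat f else 0

@[simp] theorem zcoeff_natCast {R : Type*} [Ring R] (f : PowerSeries R) (n : ℕ) :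
    zcoeff f n = PowerSeries.coeff n f := by simp [zcoeff]

theorem zcoeff_of_neg {R : Type*} [Ring R] (f : PowerSeries R) {m : ℤ} (h : m < 0) :
    zcoeff f m = 0 := if_neg (by omega)

theorem commute_zcoeff {R : Type*} [Ring R] {f g : PowerSeries R}
    (h : ∀ m n, Commute (PowerSeries.coeff m f) (PowerSeries.coeff n g)) (m n : ℤ) :
    Commute (zcoeff f m) (zcoeff g n) := by
  unfold zcoeff
  split_ifs
  · exact h _ _
  · exact Commute.zero_right _
  · exact Commute.zero_left _
  · exact Commute.zero_left _

theorem zcoeff_scale {R : Type*} [Ring R] [Algebra ℂ R] (c : ℂ) (f : PowerSeries R) (m : ℤ) :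
    zcoeff (scale c f) m = c ^ m • zcoeff f m := by
  unfold zcoeff
  split_ifs with h
  · rw [coeff_scale, ← zpow_natCast, Int.toNat_of_nonneg h]
  · rw [smul_zero]

theorem zcoeff_mul_apply (f g : PowerSeries (Module.End ℂ M)) (n : ℤ) (w : M) :
    zcoeff (f * g) n w = ∑ᶠ l : ℤ, zcoeff f l (zcoeff g (n - l) w) := by
  have hs : ∀ l, zcoeff f l (zcoeff g (n - l) w) ≠ 0 → 0 ≤ l ∧ l ≤ n := by
    intro l hl
    by_contra hcon
    refine hl ?_
    rcases lt_or_ge l 0 with h | h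
    · rw [zcoeff_of_neg f h, LinearMap.zero_apply]
    · rw [zcoeff_of_neg g (by omega), LinearMap.zero_apply, map_zero]
  rcases lt_or_ge n 0 with hn | hn
  · rw [zcoeff_of_neg _ hn, LinearMap.zero_apply, finsum_eq_zero_of_forall_eq_zero]
    intro l
    by_contra h
    have := hs l h
    omega
  · obtain ⟨m, rfl⟩ := Int.eq_ofNat_of_zero_le hn
    rw [finsum_int_eq_sum_range (m + 1) fun k hk => by have := hs k hk; push_cast; omega,
      zcoeff_natCast, PowerSeries.coeff_mul, LinearMap.sum_apply,
      Finset.Nat.sum_antidiagonal_eq_sum_range_succ_mk]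
    refine Finset.sum_congr rfl fun k hk => ?_
    have : k ≤ m := Nat.lt_succ_iff.1 (Finset.mem_range.1 hk)
    rw [← Nat.cast_sub this, zcoeff_natCast, zcoeff_natCast, Module.End.mul_apply]

/-- The coefficient of `z^m` of `C(z) A(z⁻¹)`, applied to `s`. For a creation series `C` and an
annihilation series `A` this is a normally ordered vertex operator. The sum is meaningful when only
finitely many coefficients of `A` act nontrivially on `s`. -/
def normalOrder (C A : PowerSeries (Module.End ℂ M)) (m : ℤ) (s : M) : M :=
  ∑ᶠ a : ℤ, zcoeff C (m + a) (zcoeff A a s)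

variable {C C₁ C₂ A A₁ A₂ : PowerSeries (Module.End ℂ M)}

theorem zcoeff_ne_zero {s : M} {B : ℕ} (h : ∀ b, B ≤ b → PowerSeries.coeff b A s = 0) {a : ℤ}
    (ha : zcoeff A a s ≠ 0) : 0 ≤ a ∧ a < B := by
  by_contra hcon
  refine ha ?_
  unfold zcoeff
  split_ifs with h0
  · exact h _ (by omega)
  · rfl

theorem normalOrder_eq_sum {s : M} {B : ℕ} (h : ∀ b, B ≤ b → PowerSeries.coeff b A s = 0) (m : ℤ) :
    normalOrder C A m s = ∑ b ∈ Finset.range B, zcoeff C (m + b) (PowerSeries.coeff b A s) := by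
  rw [normalOrder, finsum_int_eq_sum_range B fun k hk => zcoeff_ne_zero h fun h0 => hk (by
    rw [h0, map_zero])]
  simp only [zcoeff_natCast]

theorem normalOrder_sum (hA : ∀ s, ∃ B : ℕ, ∀ b, B ≤ b → PowerSeries.coeff b A s = 0) {ι : Type*}
    (t : Finset ι) (v : ι → M) (m : ℤ) :
    normalOrder C A m (∑ i ∈ t, v i) = ∑ i ∈ t, normalOrder C A m (v i) := by
  unfold normalOrder
  rw [← finsum_sum_comm]
  · simp only [map_sum]
  · intro i _
    obtain ⟨B, hB⟩ := hA (v i)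
    refine finite_support_of_bounds 0 B fun k hk => ?_
    have := zcoeff_ne_zero hB (a := k) fun h0 => hk (by rw [h0, map_zero])
    omega

theorem normalOrder_smul (C A : PowerSeries (Module.End ℂ M)) (m : ℤ) (c : ℂ) (s : M) :
    normalOrder C A m (c • s) = c • normalOrder C A m s := by
  unfold normalOrder
  rw [smul_finsum]
  simp only [map_smul]

/-- Moving a normally ordered series past a coefficient of another creation series `F`, when its
annihilation part satisfies an exchange relation with `F`. -/
theorem normalOrder_coeff (hA : ∀ s, ∃ B : ℕ, ∀ b, B ≤ b → PowerSeries.coeff b A s = 0)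
    {F : PowerSeries (Module.End ℂ M)} {f : ℕ → ℂ}
    (hAF : ∀ l, A * PowerSeries.C (PowerSeries.coeff l F) = ∑ x ∈ antidiagonal l,
      f x.1 • (PowerSeries.X ^ x.1 * (PowerSeries.C (PowerSeries.coeff x.2 F) * A)))
    (hCF : ∀ m n, Commute (PowerSeries.coeff m C) (PowerSeries.coeff n F)) (m : ℤ) (l : ℕ) (v : M) :
    normalOrder C A m (PowerSeries.coeff l F v) = ∑ x ∈ antidiagonal l,
      f x.1 • PowerSeries.coeff x.2 F (normalOrder C A (m + x.1) v) := by
  have key : ∀ a : ℤ, zcoeff A a (PowerSeries.coeff l F v) = ∑ x ∈ antidiagonal l,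
      f x.1 • PowerSeries.coeff x.2 F (zcoeff A (a - x.1) v) := by
    intro a
    rcases lt_or_ge a 0 with ha | ha
    · rw [zcoeff_of_neg _ ha, LinearMap.zero_apply, Finset.sum_eq_zero]
      intro x _
      rw [zcoeff_of_neg _ (by omega), LinearMap.zero_apply, map_zero, smul_zero]
    · obtain ⟨a, rfl⟩ := Int.eq_ofNat_of_zero_le ha
      have := LinearMap.congr_fun (congrArg (PowerSeries.coeff a) (hAF l)) v
      rw [PowerSeries.coeff_mul_C, Module.End.mul_apply, map_sum, LinearMap.sum_apply] at this
      rw [zcoeff_natCast, this]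
      refine Finset.sum_congr rfl fun x _ => ?_
      rw [coeff_smul', LinearMap.smul_apply, PowerSeries.coeff_X_pow_mul']
      split_ifs with h
      · rw [PowerSeries.coeff_C_mul, Module.End.mul_apply, ← Nat.cast_sub h, zcoeff_natCast]
      · rw [zcoeff_of_neg _ (by omega), LinearMap.zero_apply]
        simp
  obtain ⟨B, hB⟩ := hA v
  have hfin : ∀ (n : ℕ) (g : ℤ → Module.End ℂ M),
      (Function.support fun a : ℤ => g a (zcoeff A (a - n) v)).Finite := fun n g => by
    refine finite_support_of_bounds n (n + B) fun k hk => ?_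
    have := zcoeff_ne_zero hB (a := k - n) fun h0 => hk (by rw [h0, map_zero])
    omega
  have e : ∀ x : ℕ × ℕ, f x.1 • PowerSeries.coeff x.2 F (normalOrder C A (m + x.1) v) =
      ∑ᶠ a : ℤ, f x.1 • zcoeff C (m + a) (PowerSeries.coeff x.2 F (zcoeff A (a - x.1) v)) := by
    intro x
    rw [← smul_finsum]
    congr 1
    rw [normalOrder, ← finsum_comp_equiv (Equiv.subRight (x.1 : ℤ)), map_finsum]
    · refine finsum_congr fun a => ?_
      rw [Equiv.subRight_apply, show m + x.1 + (a - x.1) = m + a by ring,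
        ← zcoeff_natCast F, ← Module.End.mul_apply, ← Module.End.mul_apply,
        ← (commute_zcoeff hCF _ _).eq]
      rfl
    · exact hfin x.1 fun a => zcoeff C (m + x.1 + (a - x.1))
  rw [Finset.sum_congr rfl fun x _ => e x, ← finsum_sum_comm]
  · unfold normalOrder
    simp only [key, map_sum, map_smul]
  · intro x _
    exact hfin x.1 fun a => f x.1 • (zcoeff C (m + a) * PowerSeries.coeff x.2 F)

theorem normalOrder_zcoeff (hA : ∀ s, ∃ B : ℕ, ∀ b, B ≤ b → PowerSeries.coeff b A s = 0)
    {F : PowerSeries (Module.End ℂ M)} {f : ℕ → ℂ}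
    (hAF : ∀ l, A * PowerSeries.C (PowerSeries.coeff l F) = ∑ x ∈ antidiagonal l,
      f x.1 • (PowerSeries.X ^ x.1 * (PowerSeries.C (PowerSeries.coeff x.2 F) * A)))
    (hCF : ∀ m n, Commute (PowerSeries.coeff m C) (PowerSeries.coeff n F)) (m c : ℤ) (v : M) :
    normalOrder C A m (zcoeff F c v) = ∑ᶠ k : ℤ, (if 0 ≤ k then f k.toNat else 0) •
      zcoeff F (c - k) (normalOrder C A (m + k) v) := by
  have hs : ∀ k, (if 0 ≤ k then f k.toNat else 0) •
      zcoeff F (c - k) (normalOrder C A (m + k) v) ≠ 0 → 0 ≤ k ∧ k ≤ c := by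
    intro k hk
    by_contra hcon
    refine hk ?_
    split_ifs with h
    · rw [zcoeff_of_neg F (by omega), LinearMap.zero_apply, smul_zero]
    · rw [zero_smul]
  rcases lt_or_ge c 0 with hc | hc
  · rw [zcoeff_of_neg _ hc, LinearMap.zero_apply, finsum_eq_zero_of_forall_eq_zero]
    · simp [normalOrder]
    · intro k
      by_contra h
      have := hs k h
      omega
  · obtain ⟨l, rfl⟩ := Int.eq_ofNat_of_zero_le hc
    rw [finsum_int_eq_sum_range (l + 1) fun k hk => by have := hs k hk; push_cast; omega,
      zcoeff_natCast, normalOrder_coeff hA hAF hCF,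
      Finset.Nat.sum_antidiagonal_eq_sum_range_succ_mk]
    refine Finset.sum_congr rfl fun k hk => ?_
    have : k ≤ l := Nat.lt_succ_iff.1 (Finset.mem_range.1 hk)
    rw [← Nat.cast_sub this, zcoeff_natCast]
    simp

/-- The coefficient of `z₁^{m₁} z₂^{m₂}` of `C₁(z₁) C₂(z₂) A₁(z₁⁻¹) A₂(z₂⁻¹)`, applied to `s`, where
the modes of `A₁` and `A₂` are cut off at `B`. The value does not depend on `B` once the modes from
`B` on annihilate `s`. -/
def normalOrderPair (C₁ C₂ A₁ A₂ : PowerSeries (Module.End ℂ M)) (B : ℕ) (s : M) (m₁ m₂ : ℤ) : M :=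
  ∑ b₁ ∈ Finset.range B, ∑ b₂ ∈ Finset.range B, zcoeff C₁ (m₁ + b₁) (zcoeff C₂ (m₂ + b₂)
    (PowerSeries.coeff b₁ A₁ (PowerSeries.coeff b₂ A₂ s)))

theorem normalOrderPair_ne_zero {B : ℕ} {s : M} {m₁ m₂ : ℤ}
    (h : normalOrderPair C₁ C₂ A₁ A₂ B s m₁ m₂ ≠ 0) :
    -(B : ℤ) ≤ m₁ ∧ -(B : ℤ) ≤ m₂ := by
  by_contra hcon
  refine h (Finset.sum_eq_zero fun b₁ h₁ => Finset.sum_eq_zero fun b₂ h₂ => ?_)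
  rw [Finset.mem_range] at h₁ h₂
  rcases lt_or_ge (m₁ + b₁) 0 with h | h
  · rw [zcoeff_of_neg C₁ h, LinearMap.zero_apply]
  · rw [zcoeff_of_neg C₂ (by omega), LinearMap.zero_apply, map_zero]

theorem finite_support_normalOrderPair (B : ℕ) (s : M) (m₁ m₂ : ℤ) (g : ℤ → ℂ) :
    (Function.support fun k : ℤ =>
      g k • normalOrderPair C₁ C₂ A₁ A₂ B s (m₁ + k) (m₂ - k)).Finite := by
  refine finite_support_of_bounds (-B - m₁) (m₂ + B) fun k hk => ?_
  have := normalOrderPair_ne_zero fun h0 => hk (by rw [h0, smul_zero])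
  omega

theorem normalOrderPair_swap (hC : ∀ m n, Commute (PowerSeries.coeff m C₁) (PowerSeries.coeff n C₂))
    (hA : ∀ m n, Commute (PowerSeries.coeff m A₁) (PowerSeries.coeff n A₂))
    (B : ℕ) (s : M) (m₁ m₂ : ℤ) :
    normalOrderPair C₂ C₁ A₂ A₁ B s m₂ m₁ = normalOrderPair C₁ C₂ A₁ A₂ B s m₁ m₂ := by
  unfold normalOrderPair
  rw [Finset.sum_comm]
  refine Finset.sum_congr rfl fun b₁ _ => Finset.sum_congr rfl fun b₂ _ => ?_
  rw [← Module.End.mul_apply, ← Module.End.mul_apply (PowerSeries.coeff b₂ A₂),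
    ← (commute_zcoeff hC _ _).eq, ← (hA b₁ b₂).eq]
  rfl

/-- The operator product expansion: the product of two normally ordered series is `f(z₂ / z₁)` times
their joint normally ordered product. -/
theorem normalOrder_normalOrder
    (hA₁ : ∀ s, ∃ B : ℕ, ∀ b, B ≤ b → PowerSeries.coeff b A₁ s = 0) {f : ℕ → ℂ}
    (hAC : ∀ l, A₁ * PowerSeries.C (PowerSeries.coeff l C₂) = ∑ x ∈ antidiagonal l,
      f x.1 • (PowerSeries.X ^ x.1 * (PowerSeries.C (PowerSeries.coeff x.2 C₂) * A₁)))
    (hC : ∀ m n, Commute (PowerSeries.coeff m C₁) (PowerSeries.coeff n C₂))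
    (hA : ∀ m n, Commute (PowerSeries.coeff m A₁) (PowerSeries.coeff n A₂))
    {B : ℕ} {s : M} (h₁ : ∀ b, B ≤ b → PowerSeries.coeff b A₁ s = 0)
    (h₂ : ∀ b, B ≤ b → PowerSeries.coeff b A₂ s = 0) (m₁ m₂ : ℤ) :
    normalOrder C₁ A₁ m₁ (normalOrder C₂ A₂ m₂ s) = ∑ᶠ k : ℤ, (if 0 ≤ k then f k.toNat else 0) •
      normalOrderPair C₁ C₂ A₁ A₂ B s (m₁ + k) (m₂ - k) := by
  rw [normalOrder_eq_sum h₂, normalOrder_sum hA₁,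
    Finset.sum_congr rfl fun b _ => normalOrder_zcoeff hA₁ hAC hC _ _ _,
    ← finsum_sum_comm]
  · refine finsum_congr fun k => ?_
    rw [← Finset.smul_sum]
    congr 1
    rw [normalOrderPair, Finset.sum_comm]
    refine Finset.sum_congr rfl fun b₂ _ => ?_
    rw [normalOrder_eq_sum (B := B), map_sum]
    · refine Finset.sum_congr rfl fun b₁ _ => ?_
      rw [← Module.End.mul_apply, ← (commute_zcoeff hC _ _).eq, Module.End.mul_apply]
      congr 3
      ring
    · intro b hb
      rw [← Module.End.mul_apply, (hA b b₂).eq, Module.End.mul_apply, h₁ b hb, map_zero]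
  · intro b _
    refine finite_support_of_bounds 0 (m₂ + b) fun k hk => ?_
    by_contra hcon
    refine hk ?_
    split_ifs with h
    · rw [zcoeff_of_neg C₂ (by omega), LinearMap.zero_apply, smul_zero]
    · rw [zero_smul]

/-- The sum on the left is the coefficient of `z₁^{m₁} z₂^{m₂}` of `δ(c z₂ / z₁)` times the normally
ordered product, so that `z₁ = c z₂` may be substituted in the latter. -/
theorem finsum_zpow_smul_normalOrderPair {c : ℂ} (hc : c ≠ 0) (B : ℕ) (s : M) (m₁ m₂ : ℤ) :
    ∑ᶠ k : ℤ, c ^ k • normalOrderPair C₁ C₂ A₁ A₂ B s (m₁ + k) (m₂ - k) =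
      c ^ (-m₁) • ∑ b₁ ∈ Finset.range B, ∑ b₂ ∈ Finset.range B,
        zcoeff (scale c C₁ * C₂) (m₁ + m₂ + (b₁ + b₂ : ℕ))
          (PowerSeries.coeff b₁ (scale c⁻¹ A₁) (PowerSeries.coeff b₂ A₂ s)) := by
  have h0 : ∀ (b₁ b₂ : ℕ) (w : M) (k : ℤ), ¬(-m₁ - b₁ ≤ k ∧ k ≤ m₂ + b₂) →
      zcoeff C₁ (m₁ + k + b₁) (zcoeff C₂ (m₂ - k + b₂) w) = 0 := by
    intro b₁ b₂ w k hcon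
    rcases lt_or_ge (m₁ + k + b₁) 0 with h | h
    · rw [zcoeff_of_neg C₁ h, LinearMap.zero_apply]
    · rw [zcoeff_of_neg C₂ (by omega), LinearMap.zero_apply, map_zero]
  simp only [normalOrderPair, Finset.smul_sum]
  rw [finsum_sum_comm]
  · refine Finset.sum_congr rfl fun b₁ _ => ?_
    rw [finsum_sum_comm]
    · refine Finset.sum_congr rfl fun b₂ _ => ?_
      rw [zcoeff_mul_apply, smul_finsum]
      refine Eq.trans (finsum_congr fun k => ?_) (finsum_comp_equiv (Equiv.addRight (m₁ + b₁)))
      simp only [Equiv.coe_addRight]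
      rw [zcoeff_scale, coeff_scale, LinearMap.smul_apply, LinearMap.smul_apply,
        map_smul, map_smul, smul_smul, smul_smul, inv_pow, ← zpow_natCast, ← zpow_neg,
        ← zpow_add₀ hc, ← zpow_add₀ hc, show -m₁ + (k + (m₁ + b₁)) + -(b₁ : ℤ) = k by ring,
        show k + (m₁ + b₁) = m₁ + k + b₁ by ring,
        show m₁ + m₂ + ((b₁ + b₂ : ℕ) : ℤ) - (m₁ + k + b₁) = m₂ - k + b₂ by push_cast; ring]
    · intro b₂ _
      refine finite_support_of_bounds (-m₁ - b₁) (m₂ + b₂) fun k hk => ?_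
      by_contra hcon
      exact hk (by rw [h0 _ _ _ _ hcon, smul_zero])
  · intro b₁ _
    refine finite_support_of_bounds (-m₁ - b₁) (m₂ + B) fun k hk => ?_
    by_contra hcon
    refine hk (Finset.sum_eq_zero fun b₂ hb₂ => ?_)
    rw [Finset.mem_range] at hb₂
    rw [h0 _ _ _ _ (by omega), smul_zero]

/-- Collecting the modes of `A₁` and `A₂` of total degree `n` into the product `A₁ A₂`. -/
theorem sum_range_sum_range_eq (g : ℤ → Module.End ℂ M)
    (hA : ∀ m n, Commute (PowerSeries.coeff m A₁) (PowerSeries.coeff n A₂))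
    {B : ℕ} {s : M} (h₁ : ∀ b, B ≤ b → PowerSeries.coeff b A₁ s = 0)
    (h₂ : ∀ b, B ≤ b → PowerSeries.coeff b A₂ s = 0) :
    ∑ b₁ ∈ Finset.range B, ∑ b₂ ∈ Finset.range B,
        g (b₁ + b₂ : ℕ) (PowerSeries.coeff b₁ A₁ (PowerSeries.coeff b₂ A₂ s)) =
      ∑ᶠ n : ℤ, g n (zcoeff (A₁ * A₂) n s) := by
  have h0 : ∀ b₁ b₂ : ℕ, ¬(b₁ < B ∧ b₂ < B) →
      PowerSeries.coeff b₁ A₁ (PowerSeries.coeff b₂ A₂ s) = 0 := by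
    intro b₁ b₂ h
    rcases lt_or_ge b₂ B with hb | hb
    · rw [← Module.End.mul_apply, (hA b₁ b₂).eq, Module.End.mul_apply, h₁ _ (by omega), map_zero]
    · rw [h₂ _ hb, map_zero]
  have hc : ∀ n : ℕ, PowerSeries.coeff n (A₁ * A₂) s =
      ∑ x ∈ antidiagonal n, PowerSeries.coeff x.1 A₁ (PowerSeries.coeff x.2 A₂ s) := by
    intro n
    rw [PowerSeries.coeff_mul, LinearMap.sum_apply]
    rfl
  rw [finsum_int_eq_sum_range (2 * B), ← Finset.sum_product',
    ← Finset.sum_fiberwise_of_maps_to (t := Finset.range (2 * B)) (g := fun x => x.1 + x.2)]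
  · refine Finset.sum_congr rfl fun n _ => ?_
    rw [zcoeff_natCast, hc, map_sum]
    refine Eq.trans (Finset.sum_subset ?_ ?_) (Finset.sum_congr rfl fun x hx => ?_)
    · intro x hx
      exact mem_antidiagonal.2 (Finset.mem_filter.1 hx).2
    · intro x hx hx'
      rw [h0, map_zero]
      intro h
      exact hx' (by simpa [h] using mem_antidiagonal.1 hx)
    · rw [mem_antidiagonal.1 hx]
  · intro x hx
    simp only [Finset.mem_product, Finset.mem_range] at hx ⊢
    omega
  · refine fun k hk => zcoeff_ne_zero (A := A₁ * A₂) (s := s) (fun b hb => ?_) fun h0 =>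
      hk (by rw [h0, map_zero])
    rw [hc]
    refine Finset.sum_eq_zero fun x hx => h0 _ _ ?_
    have := mem_antidiagonal.1 hx
    omega

theorem zcoeff_one {R : Type*} [Ring R] (n : ℤ) :
    zcoeff (1 : PowerSeries R) n = if n = 0 then 1 else 0 := by
  unfold zcoeff
  rw [PowerSeries.coeff_one]
  split_ifs <;> first | rfl | omega

theorem finsum_zpow_smul_normalOrderPair_eq {c : ℂ} (hc : c ≠ 0)
    (hA : ∀ m n, Commute (PowerSeries.coeff m A₁) (PowerSeries.coeff n A₂))
    {B : ℕ} {s : M} (h₁ : ∀ b, B ≤ b → PowerSeries.coeff b A₁ s = 0)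
    (h₂ : ∀ b, B ≤ b → PowerSeries.coeff b A₂ s = 0) (m₁ m₂ : ℤ) :
    ∑ᶠ k : ℤ, c ^ k • normalOrderPair C₁ C₂ A₁ A₂ B s (m₁ + k) (m₂ - k) =
      c ^ (-m₁) • ∑ᶠ n : ℤ, zcoeff (scale c C₁ * C₂) (m₁ + m₂ + n)
        (zcoeff (scale c⁻¹ A₁ * A₂) n s) := by
  rw [finsum_zpow_smul_normalOrderPair hc,
    sum_range_sum_range_eq (fun n => zcoeff (scale c C₁ * C₂) (m₁ + m₂ + n)) _ _ h₂]
  · intro m n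
    rw [coeff_scale]
    exact (hA m n).smul_left _
  · intro b hb
    rw [coeff_scale, LinearMap.smul_apply, h₁ b hb, smul_zero]

/-- If the creation parts cancel at `z₁ = c z₂`, only annihilation operators remain. -/
theorem finsum_zpow_smul_normalOrderPair_of_left {c : ℂ} (hc : c ≠ 0)
    (hA : ∀ m n, Commute (PowerSeries.coeff m A₁) (PowerSeries.coeff n A₂))
    {B : ℕ} {s : M} (h₁ : ∀ b, B ≤ b → PowerSeries.coeff b A₁ s = 0)
    (h₂ : ∀ b, B ≤ b → PowerSeries.coeff b A₂ s = 0) (h : scale c C₁ * C₂ = 1) (m₁ m₂ : ℤ) :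
    ∑ᶠ k : ℤ, c ^ k • normalOrderPair C₁ C₂ A₁ A₂ B s (m₁ + k) (m₂ - k) =
      c ^ (-m₁) • zcoeff (scale c⁻¹ A₁ * A₂) (-(m₁ + m₂)) s := by
  rw [finsum_zpow_smul_normalOrderPair_eq hc hA h₁ h₂, finsum_eq_single _ (-(m₁ + m₂)), h,
    zcoeff_one, if_pos (by ring), Module.End.one_apply]
  intro n hn
  rw [h, zcoeff_one, if_neg (by omega), LinearMap.zero_apply]

/-- If the annihilation parts cancel at `z₁ = c z₂`, only creation operators remain. -/
theorem finsum_zpow_smul_normalOrderPair_of_right {c : ℂ} (hc : c ≠ 0)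
    (hA : ∀ m n, Commute (PowerSeries.coeff m A₁) (PowerSeries.coeff n A₂))
    {B : ℕ} {s : M} (h₁ : ∀ b, B ≤ b → PowerSeries.coeff b A₁ s = 0)
    (h₂ : ∀ b, B ≤ b → PowerSeries.coeff b A₂ s = 0) (h : scale c⁻¹ A₁ * A₂ = 1) (m₁ m₂ : ℤ) :
    ∑ᶠ k : ℤ, c ^ k • normalOrderPair C₁ C₂ A₁ A₂ B s (m₁ + k) (m₂ - k) =
      c ^ (-m₁) • zcoeff (scale c C₁ * C₂) (m₁ + m₂) s := by
  rw [finsum_zpow_smul_normalOrderPair_eq hc hA h₁ h₂, finsum_eq_single _ 0, h, zcoeff_one,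
    if_pos rfl, Module.End.one_apply, add_zero]
  intro n hn
  rw [h, zcoeff_one, if_neg hn, LinearMap.zero_apply, map_zero]

/-- The coefficient `P^k [k + 1]` of `x^k` in `1 / ((1 - t P x)(1 - t⁻¹ P x))`, where
`[k] = (t^k - t^{-k}) / (t - t⁻¹)`. -/
def contraction (P t : ℂ) (k : ℕ) : ℂ := P ^ k * ((t ^ (k + 1) - t⁻¹ ^ (k + 1)) / (t - t⁻¹))

theorem contraction_zero {P t : ℂ} (h : t - t⁻¹ ≠ 0) : contraction P t 0 = 1 := by
  simp [contraction, h]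

/-- `1 / ((1 - t P x)(1 - t⁻¹ P x))` is the exponential of
`∑_{n ≥ 1} P^n (t^n + t^{-n}) x^n / n`. -/
theorem natCast_mul_contraction {P t : ℂ} (ht : t ≠ 0) {κ : ℕ → ℂ}
    (hκ : ∀ n, n ≠ 0 → n * κ n = P ^ n * (t ^ n + t⁻¹ ^ n)) (m : ℕ) :
    m * contraction P t m = ∑ x ∈ antidiagonal m, contraction P t x.1 * (x.2 * κ x.2) := by
  -- `(t^n + t^{-n}) [k] = [k + n] + [k - n]`; the second terms cancel in pairs under
  -- `k ↦ m - 1 - k`.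
  set g : ℕ → ℂ := fun k => t ^ (2 * k + 1 - m : ℤ) with hg
  have term : ∀ k ∈ Finset.range m, contraction P t k * ((m - k : ℕ) * κ (m - k)) =
      contraction P t m + P ^ m / (t - t⁻¹) * (g k - g (m - 1 - k)) := by
    intro k hk
    rw [Finset.mem_range] at hk
    obtain ⟨n, rfl⟩ : ∃ n, m = k + n + 1 := ⟨m - k - 1, by omega⟩
    rw [hκ _ (by omega), hg, contraction, contraction]
    dsimp only
    have e₁ : k + n + 1 - k = n + 1 := by omega
    have e₂ : (2 * (k : ℤ) + 1 - ((k + n + 1 : ℕ) : ℤ)) = k - n := by push_cast; ring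
    have e₃ : (2 * ((k + n + 1 - 1 - k : ℕ) : ℤ) + 1 - ((k + n + 1 : ℕ) : ℤ)) = n - k := by
      rw [show k + n + 1 - 1 - k = n by omega]; push_cast; ring
    rw [e₁, e₂, e₃, zpow_sub₀ ht, zpow_sub₀ ht]
    simp only [zpow_natCast, inv_pow]
    rw [show (t ^ (k + 1) - (t ^ (k + 1))⁻¹) / (t - t⁻¹)
      = (t ^ (k + 1) - (t ^ (k + 1))⁻¹) * (t - t⁻¹)⁻¹ from div_eq_mul_inv _ _]
    generalize hτ : (t - t⁻¹)⁻¹ = τ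
    rw [div_eq_mul_inv, div_eq_mul_inv (P ^ _), hτ]
    field_simp
    ring
  rw [Finset.Nat.sum_antidiagonal_eq_sum_range_succ_mk, Finset.sum_range_succ,
    Finset.sum_congr rfl term, Finset.sum_add_distrib, ← Finset.mul_sum, Finset.sum_sub_distrib,
    Finset.sum_range_reflect]
  simp

/-- The expansions of the two contractions, in `x` and in `x⁻¹`, differ by a combination of two
delta functions. -/
theorem contraction_sub_contraction (P t : ℂ) (k : ℤ) :
    (P * if 0 ≤ k - 1 then contraction P t (k - 1).toNat else 0)
      - (P⁻¹ * if 0 ≤ -1 - k then contraction P⁻¹ t (-1 - k).toNat else 0) =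
    (t - t⁻¹)⁻¹ * ((P * t) ^ k - (P * t⁻¹) ^ k) := by
  unfold contraction
  rcases lt_trichotomy k 0 with h | rfl | h
  · obtain ⟨n, rfl⟩ : ∃ n : ℕ, k = -((n : ℤ) + 1) := ⟨(-1 - k).toNat, by omega⟩
    rw [if_neg (by omega), if_pos (by omega), show (-1 - -((n : ℤ) + 1)).toNat = n by omega,
      zpow_neg, zpow_neg, mul_zero, zero_sub, div_eq_mul_inv]
    norm_cast
    rw [mul_pow, mul_pow, mul_inv, mul_inv, ← inv_pow, ← inv_pow, ← inv_pow, inv_inv, pow_succ P⁻¹]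
    ring
  · simp
  · obtain ⟨n, rfl⟩ : ∃ n : ℕ, k = (n : ℤ) + 1 := ⟨(k - 1).toNat, by omega⟩
    rw [if_pos (by omega), if_neg (by omega), show ((n : ℤ) + 1 - 1).toNat = n by omega,
      mul_zero, sub_zero, div_eq_mul_inv]
    norm_cast
    rw [mul_pow, mul_pow, pow_succ P]
    ring

/-- The commutator of two normally ordered series. The shifts by one and the factors `P`, `P⁻¹` are
the contribution of the zero modes. -/
theorem normalOrder_commutator (hA₁ : ∀ s, ∃ B : ℕ, ∀ b, B ≤ b → PowerSeries.coeff b A₁ s = 0)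
    (hA₂ : ∀ s, ∃ B : ℕ, ∀ b, B ≤ b → PowerSeries.coeff b A₂ s = 0)
    {P t : ℂ} (hP : P ≠ 0) (ht : t ≠ 0)
    (h12 : ∀ l, A₁ * PowerSeries.C (PowerSeries.coeff l C₂) = ∑ x ∈ antidiagonal l,
      contraction P t x.1 • (PowerSeries.X ^ x.1 *
        (PowerSeries.C (PowerSeries.coeff x.2 C₂) * A₁)))
    (h21 : ∀ l, A₂ * PowerSeries.C (PowerSeries.coeff l C₁) = ∑ x ∈ antidiagonal l,
      contraction P⁻¹ t x.1 • (PowerSeries.X ^ x.1 *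
        (PowerSeries.C (PowerSeries.coeff x.2 C₁) * A₂)))
    (hC : ∀ m n, Commute (PowerSeries.coeff m C₁) (PowerSeries.coeff n C₂))
    (hA : ∀ m n, Commute (PowerSeries.coeff m A₁) (PowerSeries.coeff n A₂))
    (hu : scale (P * t) C₁ * C₂ = 1) (hv : scale (P * t⁻¹)⁻¹ A₁ * A₂ = 1) (s : M) (m₁ m₂ : ℤ) :
    P • normalOrder C₁ A₁ (m₁ + 1) (normalOrder C₂ A₂ (m₂ - 1) s)
      - P⁻¹ • normalOrder C₂ A₂ (m₂ + 1) (normalOrder C₁ A₁ (m₁ - 1) s) =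
    (t - t⁻¹)⁻¹ • ((P * t) ^ (-m₁) • zcoeff (scale (P * t)⁻¹ A₁ * A₂) (-(m₁ + m₂)) s
      - (P * t⁻¹) ^ (-m₁) • zcoeff (scale (P * t⁻¹) C₁ * C₂) (m₁ + m₂) s) := by
  obtain ⟨B₁, hB₁⟩ := hA₁ s
  obtain ⟨B₂, hB₂⟩ := hA₂ s
  set B := max B₁ B₂ with hB
  have h₁ : ∀ b, B ≤ b → PowerSeries.coeff b A₁ s = 0 := fun b hb => hB₁ b (by omega)
  have h₂ : ∀ b, B ≤ b → PowerSeries.coeff b A₂ s = 0 := fun b hb => hB₂ b (by omega)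
  -- Both products are sums over the same joint normally ordered coefficients; shifting the index by
  -- one absorbs the zero modes.
  have e₁ : P • normalOrder C₁ A₁ (m₁ + 1) (normalOrder C₂ A₂ (m₂ - 1) s) =
      ∑ᶠ k : ℤ, (P * if 0 ≤ k - 1 then contraction P t (k - 1).toNat else 0) •
        normalOrderPair C₁ C₂ A₁ A₂ B s (m₁ + k) (m₂ - k) := by
    rw [normalOrder_normalOrder hA₁ h12 hC hA h₁ h₂, smul_finsum,
      ← finsum_comp_equiv (Equiv.subRight (1 : ℤ))]
    refine finsum_congr fun k => ?_
    rw [Equiv.subRight_apply, show m₁ + 1 + (k - 1) = m₁ + k by ring,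
      show m₂ - 1 - (k - 1) = m₂ - k by ring, smul_smul]
  have e₂ : P⁻¹ • normalOrder C₂ A₂ (m₂ + 1) (normalOrder C₁ A₁ (m₁ - 1) s) =
      ∑ᶠ k : ℤ, (P⁻¹ * if 0 ≤ -1 - k then contraction P⁻¹ t (-1 - k).toNat else 0) •
        normalOrderPair C₁ C₂ A₁ A₂ B s (m₁ + k) (m₂ - k) := by
    rw [normalOrder_normalOrder hA₂ h21 (fun m n => (hC n m).symm) (fun m n => (hA n m).symm) h₂ h₁,
      smul_finsum, ← finsum_comp_equiv (Equiv.subLeft (-1 : ℤ))]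
    refine finsum_congr fun k => ?_
    rw [Equiv.subLeft_apply, normalOrderPair_swap hC hA, show m₁ - 1 - (-1 - k) = m₁ + k by ring,
      show m₂ + 1 + (-1 - k) = m₂ - k by ring, smul_smul]
  rw [e₁, e₂, ← finsum_zpow_smul_normalOrderPair_of_left (mul_ne_zero hP ht) hA h₁ h₂ hu,
    ← finsum_zpow_smul_normalOrderPair_of_right (mul_ne_zero hP (inv_ne_zero ht)) hA h₁ h₂ hv,
    ← finsum_sub_distrib (finite_support_normalOrderPair B s m₁ m₂ _)
      (finite_support_normalOrderPair B s m₁ m₂ _),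
    ← finsum_sub_distrib (finite_support_normalOrderPair B s m₁ m₂ _)
      (finite_support_normalOrderPair B s m₁ m₂ _), smul_finsum]
  refine finsum_congr fun k => ?_
  rw [← sub_smul, ← sub_smul, smul_smul, contraction_sub_contraction]

end NormalOrder

/-! ### Heisenberg modes -/

theorem heis_natCast_succ (N : ℕ) (i : ℤ) (n : ℕ) : heis N i ((n + 1 : ℕ) : ℤ) =
    ((n : ℂ) + 1) • (MvPolynomial.pderiv ((i : ZMod N), n.succPNat)).toLinearMap := rfl

theorem heis_neg_natCast_succ (N : ℕ) (i : ℤ) (n : ℕ) : heis N i (-((n + 1 : ℕ) : ℤ)) =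
    LinearMap.mulLeft ℂ (MvPolynomial.X ((i : ZMod N), n.succPNat)) := rfl

theorem heis_zero (N : ℕ) (i : ℤ) : heis N i 0 = 0 := rfl

theorem commute_heis_pos (N : ℕ) (i j : ℤ) (m n : ℕ) :
    Commute (heis N i (m : ℤ)) (heis N j (n : ℤ)) := by
  rcases m with _ | m
  · exact Commute.zero_left _
  rcases n with _ | n
  · exact Commute.zero_right _
  rw [heis_natCast_succ, heis_natCast_succ]
  refine (Commute.smul_right ?_ _).smul_left _
  refine LinearMap.ext fun s => ?_
  -- Partial derivatives commute: their commutator is a derivation vanishing on the variables.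
  have : ⁅MvPolynomial.pderiv (R := ℂ) ((i : ZMod N), m.succPNat),
      MvPolynomial.pderiv (R := ℂ) ((j : ZMod N), n.succPNat)⁆ = 0 := by
    refine MvPolynomial.derivation_ext fun k => ?_
    rw [Derivation.commutator_apply, MvPolynomial.pderiv_X, MvPolynomial.pderiv_X]
    simp [Pi.single_apply, apply_ite]
  have h := congrArg (fun D => D s) this
  rw [Derivation.commutator_apply, Derivation.zero_apply, sub_eq_zero] at h
  exact h

theorem commute_heis_neg (N : ℕ) (i j : ℤ) (m n : ℕ) :
    Commute (heis N i (-(m : ℤ))) (heis N j (-(n : ℤ))) := by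
  rcases m with _ | m
  · exact Commute.zero_left _
  rcases n with _ | n
  · exact Commute.zero_right _
  rw [heis_neg_natCast_succ, heis_neg_natCast_succ]
  refine LinearMap.ext fun s => ?_
  exact mul_left_comm _ _ _

/-- The Heisenberg relation `[ε_i(m), ε_j(-n)] = n δ_{ij} δ_{mn}`, for `m, n ≥ 0`. -/
theorem heis_mul_heis_neg (N : ℕ) (i j : ℤ) (m n : ℕ) :
    heis N i (m : ℤ) * heis N j (-(n : ℤ)) = heis N j (-(n : ℤ)) * heis N i (m : ℤ) +
      (if (i : ZMod N) = j ∧ m = n then (n : ℂ) else 0) • 1 := by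
  rcases m with _ | m
  · rcases n with _ | n
    · simp [heis_zero]
    · simp [heis_zero]
  rcases n with _ | n
  · simp [heis_zero]
  rw [heis_natCast_succ, heis_neg_natCast_succ]
  refine LinearMap.ext fun s => ?_
  change ((m : ℂ) + 1) • MvPolynomial.pderiv _ (MvPolynomial.X _ * s) =
    MvPolynomial.X _ * (((m : ℂ) + 1) • MvPolynomial.pderiv _ s) + (_ : ℂ) • s
  rw [Derivation.leibniz, MvPolynomial.pderiv_X, smul_eq_mul, smul_eq_mul, smul_add, mul_smul_comm]
  congr 1
  by_cases h : (i : ZMod N) = j ∧ m = n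
  · obtain ⟨h1, rfl⟩ := h
    rw [if_pos ⟨h1, rfl⟩, h1]
    simp
  · rw [if_neg (by simpa using h), zero_smul, Pi.single_eq_of_ne, mul_zero, smul_zero]
    intro h'
    rw [Prod.mk.injEq, Nat.succPNat_inj] at h'
    exact h ⟨h'.1.symm, h'.2.symm⟩

/-- The series `∑_n (x_n ε_i(σ n) + y_n ε_j(σ n)) z^n`. The values of `x` and `y` at `0` do not
matter, as `heis` vanishes there. -/
def heisSeries (N : ℕ) (σ : ℤˣ) (i j : ℤ) (x y : ℕ → ℂ) : PowerSeries (Module.End ℂ (S N)) :=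
  PowerSeries.mk fun n => x n • heis N i (σ * n) + y n • heis N j (σ * n)

theorem coeff_heisSeries (N : ℕ) (σ : ℤˣ) (i j : ℤ) (x y : ℕ → ℂ) (n : ℕ) :
    PowerSeries.coeff n (heisSeries N σ i j x y) =
      x n • heis N i (σ * n) + y n • heis N j (σ * n) := PowerSeries.coeff_mk _ _

theorem coeff_zero_heisSeries (N : ℕ) (σ : ℤˣ) (i j : ℤ) (x y : ℕ → ℂ) :
    PowerSeries.coeff 0 (heisSeries N σ i j x y) = 0 := by
  simp [coeff_heisSeries, heis_zero]

theorem heisSeries_swap (N : ℕ) (σ : ℤˣ) (i j : ℤ) (x y : ℕ → ℂ) :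
    heisSeries N σ j i x y = heisSeries N σ i j y x := by
  ext1 n; rw [coeff_heisSeries, coeff_heisSeries, add_comm]

theorem heisSeries_add (N : ℕ) (σ : ℤˣ) (i j : ℤ) (x y x' y' : ℕ → ℂ) :
    heisSeries N σ i j x y + heisSeries N σ i j x' y' = heisSeries N σ i j (x + x') (y + y') := by
  ext1 n
  rw [map_add, coeff_heisSeries, coeff_heisSeries, coeff_heisSeries, Pi.add_apply, Pi.add_apply]
  module

theorem scale_heisSeries (N : ℕ) (σ : ℤˣ) (i j : ℤ) (x y : ℕ → ℂ) (c : ℂ) :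
    scale c (heisSeries N σ i j x y) =
      heisSeries N σ i j (fun n => c ^ n * x n) (fun n => c ^ n * y n) := by
  ext1 n
  rw [coeff_scale, coeff_heisSeries, coeff_heisSeries]
  module

theorem commute_heis (N : ℕ) (σ : ℤˣ) (i j : ℤ) (m n : ℕ) :
    Commute (heis N i (σ * m)) (heis N j (σ * n)) := by
  rcases Int.units_eq_one_or σ with rfl | rfl
  · simpa using commute_heis_pos N i j m n
  · simpa using commute_heis_neg N i j m n

theorem commute_heisSeries {N : ℕ} {σ : ℤˣ} {i j : ℤ} {x y x' y' : ℕ → ℂ} (m n : ℕ) :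
    Commute (PowerSeries.coeff m (heisSeries N σ i j x y))
      (PowerSeries.coeff n (heisSeries N σ i j x' y')) := by
  rw [coeff_heisSeries, coeff_heisSeries]
  have h := fun i j => commute_heis N σ i j m n
  exact ((((h i i).smul_right _).add_right ((h i j).smul_right _)).smul_left _).add_left
    ((((h j i).smul_right _).add_right ((h j j).smul_right _)).smul_left _)

theorem heisSeries_mul_heisSeries (N : ℕ) {i j : ℤ} (hij : (i : ZMod N) ≠ j) (x y x' y' : ℕ → ℂ)
    (m n : ℕ) :
    PowerSeries.coeff m (heisSeries N 1 i j x y) *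
        PowerSeries.coeff n (heisSeries N (-1) i j x' y') =
      PowerSeries.coeff n (heisSeries N (-1) i j x' y') *
          PowerSeries.coeff m (heisSeries N 1 i j x y) +
        (if m = n then n * (x n * x' n + y n * y' n) else 0) • 1 := by
  have h := fun i j => heis_mul_heis_neg N i j m n
  rw [coeff_heisSeries, coeff_heisSeries]
  simp only [Units.val_neg, Units.val_one, neg_mul, one_mul, add_mul, mul_add, smul_mul_smul_comm,
    h, hij, hij.symm, false_and, true_and, if_false, zero_smul, add_zero, smul_add]
  split_ifs with hmn
  · subst hmn
    module
  · module

/-- `exp(∑_n (x_n ε_i(σ n) + y_n ε_j(σ n)) z^n)`: a creation series for `σ = -1`, an annihilation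
series (in the inverse variable) for `σ = 1`. -/
abbrev expHeis (N : ℕ) (σ : ℤˣ) (i j : ℤ) (x y : ℕ → ℂ) : PowerSeries (Module.End ℂ (S N)) :=
  expSeries (heisSeries N σ i j x y)

theorem expHeis_mul (N : ℕ) (σ : ℤˣ) (i j : ℤ) (x y x' y' : ℕ → ℂ) :
    expHeis N σ i j x y * expHeis N σ i j x' y' = expHeis N σ i j (x + x') (y + y') := by
  rw [expHeis, expHeis, ← expSeries_add (coeff_zero_heisSeries ..) (coeff_zero_heisSeries ..)
    commute_heisSeries commute_heisSeries commute_heisSeries, heisSeries_add]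

theorem scale_expHeis (N : ℕ) (σ : ℤˣ) (i j : ℤ) (x y : ℕ → ℂ) (c : ℂ) :
    scale c (expHeis N σ i j x y) =
      expHeis N σ i j (fun n => c ^ n * x n) (fun n => c ^ n * y n) := by
  rw [expHeis, ← expSeries_scale c (coeff_zero_heisSeries ..) commute_heisSeries,
    scale_heisSeries]

theorem expHeis_zero (N : ℕ) (σ : ℤˣ) (i j : ℤ) : expHeis N σ i j 0 0 = 1 := by
  rw [expHeis, ← expSeries_zero]
  congr 1
  ext1 n
  simp [coeff_heisSeries]

theorem commute_expHeis {N : ℕ} {σ : ℤˣ} {i j : ℤ} {x y x' y' : ℕ → ℂ} (m n : ℕ) :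
    Commute (PowerSeries.coeff m (expHeis N σ i j x y))
      (PowerSeries.coeff n (expHeis N σ i j x' y')) :=
  commute_coeff_expSeries (coeff_zero_heisSeries ..) commute_heisSeries (fun _ =>
    (commute_coeff_expSeries (coeff_zero_heisSeries ..) commute_heisSeries
      (fun _ => commute_heisSeries _ _) _).symm) _

theorem expHeis_mul_C_coeff (N : ℕ) {i j : ℤ} (hij : (i : ZMod N) ≠ j) {x y x' y' : ℕ → ℂ}
    {P t : ℂ} (ht : t ≠ 0) (htt : t - t⁻¹ ≠ 0)
    (h : ∀ n : ℕ, n ≠ 0 →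
      n * (n * (x n * x' n + y n * y' n)) = P ^ n * (t ^ n + t⁻¹ ^ n)) (l : ℕ) :
    expHeis N 1 i j x y * PowerSeries.C (PowerSeries.coeff l (expHeis N (-1) i j x' y')) =
      ∑ x₁ ∈ antidiagonal l, contraction P t x₁.1 • (PowerSeries.X ^ x₁.1 *
        (PowerSeries.C (PowerSeries.coeff x₁.2 (expHeis N (-1) i j x' y')) *
          expHeis N 1 i j x y)) :=
  expSeries_mul_C_coeff_expSeries (coeff_zero_heisSeries ..) (coeff_zero_heisSeries ..)
    commute_heisSeries commute_heisSeries
    (κ := fun n => n * (x n * x' n + y n * y' n)) (by simp)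
    (heisSeries_mul_heisSeries N hij x y x' y') (contraction_zero htt)
    (natCast_mul_contraction ht h) l

theorem creation_eq (N : ℕ) (q p : ℂ) (i j r : ℤ) :
    creation N q p i j r = expHeis N (-1) i j (fun n => (n : ℂ)⁻¹)
      (fun n => -((n : ℂ)⁻¹ * (p ^ r * q ^ (i - j)) ^ n)) := by
  rw [creation, expHeis]
  congr 1
  ext1 n
  rw [PowerSeries.coeff_mk, coeff_heisSeries, mode]
  split_ifs with h
  · subst h; simp [heis_zero]
  · rw [abs_neg, Nat.abs_cast, neg_mul_neg, mul_pow, zpow_mul, zpow_mul, zpow_natCast,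
      zpow_natCast]
    simp only [Units.val_neg, Units.val_one, neg_mul, one_mul, Int.cast_neg, Int.cast_natCast,
      inv_neg]
    module

theorem annihilation_eq (N : ℕ) (q p : ℂ) (i j r : ℤ) :
    annihilation N q p i j r = expHeis N 1 i j (fun n => -(n : ℂ)⁻¹)
      (fun n => (n : ℂ)⁻¹ * (p ^ (-r) * q ^ (i - j)) ^ n) := by
  rw [annihilation, expHeis]
  congr 1
  ext1 n
  rw [PowerSeries.coeff_mk, coeff_heisSeries, mode]
  split_ifs with h
  · subst h; simp [heis_zero]
  · rw [Nat.abs_cast, mul_pow, zpow_mul, zpow_mul, zpow_natCast, zpow_natCast]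
    simp only [Units.val_one, one_mul, Int.cast_natCast]
    module

theorem normalExp_apply (N : ℕ) (q p : ℂ) (i j r m : ℤ) (s : S N) :
    normalExp N q p i j r m s =
      normalOrder (creation N q p i j r) (annihilation N q p i j r) m s := by
  obtain ⟨B, hB⟩ := annihilation_finite N q p i j r s
  rw [normalOrder_eq_sum hB]
  change ∑ᶠ b : ℕ, _ = _
  rw [finsum_eq_sum_of_support_subset (s := Finset.range B)]
  · refine Finset.sum_congr rfl fun b _ => ?_
    dsimp only
    rw [zcoeff]
    split_ifs <;> rfl
  · intro b hb
    rw [Finset.coe_range, Set.mem_Iio]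
    by_contra hlt
    refine hb ?_
    dsimp only
    split_ifs
    · rw [Module.End.mul_apply, hB b (not_lt.1 hlt), map_zero]
    · rfl

/-! ### The lattice, and formal distributions -/

theorem root_swap (N : ℕ) (i j : ℤ) : root N j i = -root N i j :=
  Subtype.ext (neg_sub _ _).symm

theorem coe_root {N : ℕ} (i j : ℤ) : (root N i j : P N) = eps N i - eps N j := rfl

section Form

variable {N : ℕ} [NeZero N]

theorem form_add_right (x y z : P N) : form x (y + z) = form x y + form x z := by
  simp [form, mul_add, Finset.sum_add_distrib]

theorem form_sub_left (x y z : P N) : form (x - y) z = form x z - form y z := by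
  simp [form, sub_mul, Finset.sum_sub_distrib]

theorem form_sub_right (x y z : P N) : form x (y - z) = form x y - form x z := by
  simp [form, mul_sub, Finset.sum_sub_distrib]

theorem form_eps_eps (i j : ℤ) :
    form (eps N i) (eps N j) = if (i : ZMod N) = j then 1 else 0 := by
  simp [form, eps, Pi.single_apply, eq_comm]

theorem form_neg_left (x y : P N) : form (-x) y = -form x y := by
  simp [form]

theorem form_neg_right (x y : P N) : form x (-y) = -form x y := by
  simp [form]

theorem form_root_root {i j : ℤ} (hij : (i : ZMod N) ≠ j) :
    form (root N i j : P N) (root N i j : P N) = 2 := by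
  simp [coe_root, form_sub_right, form_sub_left, form_eps_eps, hij, hij.symm]

theorem form_eps_root {i j : ℤ} (hij : (i : ZMod N) ≠ j) :
    form (eps N j) (root N i j : P N) = -1 := by
  simp [coe_root, form_sub_right, form_eps_eps, hij.symm]

end Form

theorem gradedOp_single {N : ℕ} (β : Q N) (f : Q N → Module.End ℂ (S N)) (γ : Q N) (s : S N) :
    gradedOp β f (Finsupp.single γ s) = Finsupp.single (γ + β) (f γ s) := by
  simp [gradedOp]

section Distributions

variable {M : Type*} [AddCommGroup M] [Module ℂ M]

theorem mulOne_deltaOneTwo (f : ℤ → M) (c : ℂ) (a b : ℤ) :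
    mulOne f (deltaOneTwo c) a b = c ^ (-b) • f (a + b) := by
  rw [mulOne, finsum_eq_single _ (a + b)]
  · rw [deltaOneTwo, if_pos (by ring), show a - (a + b) = -b by ring]
  · intro k hk
    rw [deltaOneTwo, if_neg (by omega), zero_smul]

theorem mulTwo_deltaTwoOne (f : ℤ → M) (c : ℂ) (a b : ℤ) :
    mulTwo f (deltaTwoOne c) a b = c ^ (-a) • f (a + b) := by
  rw [mulTwo, finsum_eq_single _ (a + b)]
  · rw [deltaTwoOne, if_pos (by ring), show b - (a + b) = -a by ring]
  · intro k hk
    rw [deltaTwoOne, if_neg (by omega), zero_smul]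

end Distributions

/-! ### Action on `s ⊗ e^γ` -/

theorem zpow_sub_mul_natCast (x : ℂ) (i j : ℤ) (n : ℕ) :
    x ^ ((j - i) * (n : ℤ)) = (x ^ (j - i)) ^ n := by
  rw [zpow_mul, zpow_natCast]

theorem zpow_sub_mul_natCast' (x : ℂ) (i j : ℤ) (n : ℕ) :
    x ^ ((i - j) * (n : ℤ)) = (x ^ (j - i))⁻¹ ^ n := by
  rw [← neg_sub j i, zpow_mul, zpow_neg, zpow_natCast]

/-- The action of `u_{ij}(-r, z)` on `s ⊗ e^γ`, in terms of `q^{j-i}`, `q^{(j-i)/2}` and `p^r`. -/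
theorem seriesU_single {N : ℕ} [NeZero N] (q p sq : ℂ) (i j r m : ℤ) (γ : Q N) (s : S N) :
    seriesU q p sq i j (-r) m (Finsupp.single γ s) =
      Finsupp.single γ ((q ^ (j - i)) ^ form (root N i j : P N) (γ : P N) •
        zcoeff (expHeis N 1 i j
          (fun n => ((q ^ (j - i)) ^ n - (q ^ (j - i))⁻¹ ^ n) / n * (sq ^ (j - i)) ^ n)
          (fun n => -(((q ^ (j - i)) ^ n - (q ^ (j - i))⁻¹ ^ n) / n *
            ((p ^ r) ^ n * (sq ^ (j - i))⁻¹ ^ n)))) (-m) s) := by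
  rw [seriesU, zcoeff]
  by_cases h : m ≤ 0
  · rw [if_pos h, if_pos (by omega), gradedOp_single, add_zero, LinearMap.smul_apply, expHeis,
      zpow_mul]
    congr 5
    ext1 n
    rw [PowerSeries.coeff_mk, coeff_heisSeries, Units.val_one, one_mul, zpow_sub_mul_natCast q i j,
      zpow_sub_mul_natCast sq i j, zpow_sub_mul_natCast' q i j, zpow_sub_mul_natCast' sq i j,
      neg_mul_neg, mul_comm _ r, zpow_mul p, zpow_natCast]
    module
  · rw [if_neg h, if_neg (by omega)]
    simp

/-- The action of `v_{ij}(-r, z)` on `s ⊗ e^γ`, in terms of `q^{j-i}`, `q^{(j-i)/2}` and `p^r`. -/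
theorem seriesV_single {N : ℕ} [NeZero N] (q p sq : ℂ) (i j r m : ℤ) (γ : Q N) (s : S N) :
    seriesV q p sq i j (-r) m (Finsupp.single γ s) =
      Finsupp.single γ ((q ^ (j - i)) ^ (-form (root N i j : P N) (γ : P N)) •
        zcoeff (expHeis N (-1) i j
          (fun n => ((q ^ (j - i))⁻¹ ^ n - (q ^ (j - i)) ^ n) / n * (sq ^ (j - i)) ^ n)
          (fun n => -(((q ^ (j - i))⁻¹ ^ n - (q ^ (j - i)) ^ n) / n *
            ((p ^ r)⁻¹ ^ n * (sq ^ (j - i))⁻¹ ^ n)))) m s) := by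
  rw [seriesV, zcoeff]
  by_cases h : 0 ≤ m
  · rw [if_pos h, if_pos h, gradedOp_single, add_zero, LinearMap.smul_apply, expHeis,
      ← neg_sub j i, neg_mul_comm, zpow_mul]
    congr 5
    ext1 n
    rw [neg_sub, PowerSeries.coeff_mk, coeff_heisSeries, Units.val_neg, Units.val_one, neg_mul,
      one_mul, zpow_sub_mul_natCast q i j, zpow_sub_mul_natCast sq i j, zpow_sub_mul_natCast' q i j,
      zpow_sub_mul_natCast' sq i j,
      mul_comm _ (-r), zpow_mul p, zpow_neg, zpow_natCast]
    module
  · rw [if_neg h, if_neg h]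
    simp

theorem vertexX_single {N : ℕ} [NeZero N] (ε : Q N → Q N → ℤˣ) (q p sp : ℂ) {i j : ℤ}
    (hij : (i : ZMod N) ≠ j) (r m : ℤ) (γ : Q N) (s : S N) :
    vertexX ε q p sp i j r m (Finsupp.single γ s) =
      Finsupp.single (γ + root N i j) ((((ε (root N i j) γ : ℤ) : ℂ) *
        p ^ (-r * form (eps N j) (γ : P N)) * sp ^ r) •
          normalOrder (creation N q p i j r) (annihilation N q p i j r)
            (m - (form (root N i j : P N) (γ : P N) + 1)) s) := by
  rw [vertexX, gradedOp_single, LinearMap.smul_apply, normalExp_apply, form_eps_root hij,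
    form_root_root hij, neg_neg, one_mul]
  rfl

theorem IsCocycle.neg_left {N : ℕ} [NeZero N] {ε : Q N → Q N → ℤˣ} (hε : IsCocycle ε)
    (α β : Q N) : ε (-α) β = ε α β := by
  have h0 : ε 0 β = 1 := by
    have := hε.add_left 0 0 β
    rwa [add_zero, left_eq_mul] at this
  have := hε.add_left (-α) α β
  rw [neg_add_cancel, h0] at this
  rw [eq_inv_of_mul_eq_one_left this.symm, Int.units_inv_eq_self]

theorem IsCocycle.mul_eq_neg_one {N : ℕ} [NeZero N] {ε : Q N → Q N → ℤˣ} (hε : IsCocycle ε)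
    {α : Q N} (hα : form (α : P N) α = 2) (γ : Q N) : ε α (γ + α) * ε α γ = -1 := by
  -- `(α, α) = 2`, so `ε(α, α) = -1`.
  have h : ε α α = -1 := by rw [hε.self, hα]; rfl
  rw [hε.add_right, h, mul_neg_one, neg_mul, Int.units_mul_self]

/-! ### The product of the two vertex operators -/

section Pairing

variable (N : ℕ) (i j : ℤ) (P t : ℂ)

/-- The creation part of `X_{ij}(r₁, z)`, where `P = p^{-r₁}` and `t = q^{j-i}`. -/
abbrev creationFst : PowerSeries (Module.End ℂ (S N)) :=
  expHeis N (-1) i j (fun n => (n : ℂ)⁻¹) (fun n => -((n : ℂ)⁻¹ * (P⁻¹ * t⁻¹) ^ n))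

/-- The creation part of `X_{ji}(r₂, z)`, where `P = p^{r₂}` and `t = q^{j-i}`. -/
abbrev creationSnd : PowerSeries (Module.End ℂ (S N)) :=
  expHeis N (-1) i j (fun n => -((n : ℂ)⁻¹ * (P * t) ^ n)) (fun n => (n : ℂ)⁻¹)

/-- The annihilation part of `X_{ij}(r₁, z)`, where `P = p^{-r₁}` and `t = q^{j-i}`. -/
abbrev annihilationFst : PowerSeries (Module.End ℂ (S N)) :=
  expHeis N 1 i j (fun n => -(n : ℂ)⁻¹) (fun n => (n : ℂ)⁻¹ * (P * t⁻¹) ^ n)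

/-- The annihilation part of `X_{ji}(r₂, z)`, where `P = p^{r₂}` and `t = q^{j-i}`. -/
abbrev annihilationSnd : PowerSeries (Module.End ℂ (S N)) :=
  expHeis N 1 i j (fun n => (n : ℂ)⁻¹ * (P⁻¹ * t) ^ n) (fun n => -(n : ℂ)⁻¹)

end Pairing

/-- At `z₁ = P t z₂` the creation parts cancel. -/
theorem creation_mul_creation (N : ℕ) (i j : ℤ) {P t : ℂ} (hP : P ≠ 0) (ht : t ≠ 0) :
    scale (P * t) (creationFst N i j P t) * creationSnd N i j P t = 1 := by
  rw [scale_expHeis, expHeis_mul, ← expHeis_zero N (-1) i j]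
  congr 1 <;> funext n <;> simp only [Pi.add_apply, Pi.zero_apply]
  · ring
  · rw [mul_neg, mul_left_comm, ← mul_pow, show P * t * (P⁻¹ * t⁻¹) = 1 by field_simp]
    simp

/-- At `z₁ = P t⁻¹ z₂` the annihilation parts cancel. -/
theorem annihilation_mul_annihilation (N : ℕ) (i j : ℤ) {P t : ℂ} (hP : P ≠ 0) (ht : t ≠ 0) :
    scale (P * t⁻¹)⁻¹ (annihilationFst N i j P t) * annihilationSnd N i j P t = 1 := by
  rw [scale_expHeis, expHeis_mul, ← expHeis_zero N 1 i j]
  congr 1 <;> funext n <;> simp only [Pi.add_apply, Pi.zero_apply]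
  · rw [mul_inv, inv_inv]; ring
  · rw [mul_left_comm, ← mul_pow, inv_mul_cancel₀ (by positivity)]
    simp

/-- At `z₁ = P t z₂` the annihilation parts combine to the exponential in `u_{ij}`, at `w P z₂`. -/
theorem scale_mul_annihilation (N : ℕ) (i j : ℤ) {P t w : ℂ} (hP : P ≠ 0) (ht : t ≠ 0)
    (hw : w ^ 2 = t) :
    scale (P * t)⁻¹ (annihilationFst N i j P t) * annihilationSnd N i j P t =
      scale (w * P)⁻¹ (expHeis N 1 i j (fun n => (t ^ n - t⁻¹ ^ n) / n * w ^ n)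
        (fun n => -((t ^ n - t⁻¹ ^ n) / n * (P ^ n * w⁻¹ ^ n)))) := by
  have hw0 : w ≠ 0 := by rintro rfl; exact ht (by simp [← hw])
  subst hw
  rw [scale_expHeis, scale_expHeis, expHeis_mul]
  congr 1 <;> funext n <;> simp only [Pi.add_apply]
  all_goals
    simp only [mul_pow, mul_inv, inv_pow, pow_right_comm w 2 n, div_eq_mul_inv]
    have hW := pow_ne_zero n hw0
    have hQ := pow_ne_zero n hP
    generalize w ^ n = W at *
    generalize P ^ n = R at *
    generalize (n : ℂ)⁻¹ = ν
    field_simp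
    ring

/-- At `z₁ = P t⁻¹ z₂` the creation parts combine to the exponential in `v_{ij}`, at `w z₁`. -/
theorem scale_mul_creation (N : ℕ) (i j : ℤ) {P t w : ℂ} (hP : P ≠ 0) (ht : t ≠ 0)
    (hw : w ^ 2 = t) :
    scale (P * t⁻¹) (creationFst N i j P t) * creationSnd N i j P t =
      scale (w * (P * t⁻¹)) (expHeis N (-1) i j (fun n => (t⁻¹ ^ n - t ^ n) / n * w ^ n)
        (fun n => -((t⁻¹ ^ n - t ^ n) / n * (P⁻¹ ^ n * w⁻¹ ^ n)))) := by
  have hw0 : w ≠ 0 := by rintro rfl; exact ht (by simp [← hw])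
  subst hw
  rw [scale_expHeis, scale_expHeis, expHeis_mul]
  congr 1 <;> funext n <;> simp only [Pi.add_apply]
  all_goals
    simp only [mul_pow, inv_pow, pow_right_comm w 2 n, div_eq_mul_inv]
    have hW := pow_ne_zero n hw0
    have hQ := pow_ne_zero n hP
    generalize w ^ n = W at *
    generalize P ^ n = R at *
    generalize (n : ℂ)⁻¹ = ν
    field_simp
    ring

theorem creation_eq_fst (N : ℕ) (q p : ℂ) (i j r : ℤ) :
    creation N q p i j (-r) = creationFst N i j (p ^ r) (q ^ (j - i)) := by
  rw [creation_eq, zpow_neg, ← neg_sub j i, zpow_neg]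

theorem creation_eq_snd (N : ℕ) (q p : ℂ) (i j r : ℤ) :
    creation N q p j i r = creationSnd N i j (p ^ r) (q ^ (j - i)) := by
  rw [creation_eq, expHeis, heisSeries_swap]

theorem annihilation_eq_fst (N : ℕ) (q p : ℂ) (i j r : ℤ) :
    annihilation N q p i j (-r) = annihilationFst N i j (p ^ r) (q ^ (j - i)) := by
  rw [annihilation_eq, neg_neg, ← neg_sub j i, zpow_neg]

theorem annihilation_eq_snd (N : ℕ) (q p : ℂ) (i j r : ℤ) :
    annihilation N q p j i r = annihilationSnd N i j (p ^ r) (q ^ (j - i)) := by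
  rw [annihilation_eq, expHeis, heisSeries_swap, zpow_neg]

/-- `normalOrder_commutator` for the vertex operators on the Fock space, with `w = q^{(j-i)/2}`. -/
theorem fock_commutator (N : ℕ) (q p : ℂ) {i j : ℤ} (hij : (i : ZMod N) ≠ j) (r : ℤ)
    {P t w : ℂ} (hPr : P = p ^ r) (htq : t = q ^ (j - i)) (hP : P ≠ 0) (ht : t ≠ 0)
    (htt : t - t⁻¹ ≠ 0) (hw : w ^ 2 = t) (s : S N) (m₁ m₂ : ℤ) :
    P • normalOrder (creation N q p i j (-r)) (annihilation N q p i j (-r)) (m₁ + 1)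
        (normalOrder (creation N q p j i r) (annihilation N q p j i r) (m₂ - 1) s)
      - P⁻¹ • normalOrder (creation N q p j i r) (annihilation N q p j i r) (m₂ + 1)
        (normalOrder (creation N q p i j (-r)) (annihilation N q p i j (-r)) (m₁ - 1) s) =
    (t - t⁻¹)⁻¹ • (((P * t) ^ (-m₁) * (w * P) ^ (m₁ + m₂)) •
        zcoeff (expHeis N 1 i j (fun n => (t ^ n - t⁻¹ ^ n) / n * w ^ n)
          (fun n => -((t ^ n - t⁻¹ ^ n) / n * (P ^ n * w⁻¹ ^ n)))) (-(m₁ + m₂)) s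
      - ((P * t⁻¹) ^ (-m₁) * (w * (P * t⁻¹)) ^ (m₁ + m₂)) •
        zcoeff (expHeis N (-1) i j (fun n => (t⁻¹ ^ n - t ^ n) / n * w ^ n)
          (fun n => -((t⁻¹ ^ n - t ^ n) / n * (P⁻¹ ^ n * w⁻¹ ^ n)))) (m₁ + m₂) s) := by
  have l₁ := annihilation_finite N q p i j (-r)
  have l₂ := annihilation_finite N q p j i r
  rw [annihilation_eq_fst, ← hPr, ← htq] at l₁
  rw [annihilation_eq_snd, ← hPr, ← htq] at l₂
  rw [creation_eq_fst, creation_eq_snd, annihilation_eq_fst, annihilation_eq_snd, ← hPr, ← htq,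
    normalOrder_commutator l₁ l₂ hP ht (expHeis_mul_C_coeff N hij ht htt ?_)
      (expHeis_mul_C_coeff N hij ht htt ?_) commute_expHeis commute_expHeis
      (creation_mul_creation N i j hP ht) (annihilation_mul_annihilation N i j hP ht),
    scale_mul_annihilation N i j hP ht hw, scale_mul_creation N i j hP ht hw, zcoeff_scale,
    zcoeff_scale, LinearMap.smul_apply, LinearMap.smul_apply, smul_smul, smul_smul,
    zpow_neg _ (_ + _), inv_zpow, inv_inv]
  all_goals
    intro n hn
    have hn' : (n : ℂ) ≠ 0 := Nat.cast_ne_zero.2 hn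
    rw [mul_pow, mul_pow]
    field_simp

/-- The product of the two vertex operators on `s ⊗ e^γ`. The two lattice shifts cancel, so the zero
modes leave only a scalar and a shift of the exponents of `z₁` and `z₂`. -/
theorem vertexX_vertexX_single {N : ℕ} [NeZero N] {ε : Q N → Q N → ℤˣ} (hε : IsCocycle ε)
    (q : ℂ) {p sp : ℂ} (hp : p ≠ 0) (hsp : sp ≠ 0) {i j : ℤ} (hij : (i : ZMod N) ≠ j)
    {r r' : ℤ} (hr : r' = -r) (a b : ℤ) (γ : Q N) (s : S N) :
    vertexX ε q p sp i j r' a (vertexX ε q p sp j i r b (Finsupp.single γ s)) =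
      Finsupp.single γ (-((p ^ r) ^ (1 - form (root N i j : P N) (γ : P N))) •
        normalOrder (creation N q p i j r') (annihilation N q p i j r')
          (a - form (root N i j : P N) (γ : P N) + 1)
          (normalOrder (creation N q p j i r) (annihilation N q p j i r)
            (b + form (root N i j : P N) (γ : P N) - 1) s)) := by
  have hα : form (root N i j : P N) (root N i j : P N) = 2 := form_root_root hij
  have hj : form (eps N j) (root N i j : P N) = -1 := form_eps_root hij
  have hsign :
      ((ε (root N i j) (γ + -root N i j) : ℤ) : ℂ) * ((ε (root N i j) γ : ℤ) : ℂ) = -1 := by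
    have h := hε.mul_eq_neg_one hα (γ + -root N i j)
    rw [neg_add_cancel_right, mul_comm] at h
    rw [← Int.cast_mul, ← Units.val_mul, h]
    simp
  rw [vertexX_single ε q p sp hij.symm, vertexX_single ε q p sp hij, root_swap N i j,
    normalOrder_smul, smul_smul, neg_add_cancel_right, hε.neg_left]
  simp only [AddSubgroup.coe_add, AddSubgroup.coe_neg, form_add_right, form_neg_right,
    form_neg_left, hα, hj]
  have hx : form (root N i j : P N) (γ : P N) =
      form (eps N i) (γ : P N) - form (eps N j) (γ : P N) := form_sub_left _ _ _
  congr 2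
  · rw [mul_mul_mul_comm,
      mul_mul_mul_comm ((ε (root N i j) (γ + -root N i j) : ℤ) : ℂ), hsign, hx, hr,
      ← zpow_add₀ hp, ← zpow_add₀ hsp, neg_add_cancel, zpow_zero, mul_one, neg_one_mul, ← zpow_mul]
    congr 2
    ring
  · congr 1
    · ring
    · congr 1
      ring

end

end QVertex

theorem proposition2p37 (N : ℕ) [NeZero N] (hN : 3 ≤ N)
    (ε : QVertex.Q N → QVertex.Q N → ℤˣ) (hε : QVertex.IsCocycle ε)
    (q p sq sp : ℂ) (hq : q ≠ 0) (hq_generic : ∀ n : ℕ, 0 < n → q ^ n ≠ 1) (hp : p ≠ 0)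
    (hsq : sq ^ 2 = q) (hsp : sp ^ 2 = p)
    (i j r₁ r₂ : ℤ) (hij : (i : ZMod N) ≠ (j : ZMod N)) (hr : r₁ + r₂ = 0) :
    QVertex.commutator (QVertex.vertexX ε q p sp i j r₁) (QVertex.vertexX ε q p sp j i r₂) =
      (q ^ (j - i) - q ^ (i - j))⁻¹ •
        (QVertex.mulOne
            (QVertex.rescale (sq ^ (j - i)) (QVertex.seriesV (N := N) q p sq i j r₁))
            (QVertex.deltaOneTwo (q ^ (j - i) * p ^ r₁))
          - QVertex.mulTwo
            (QVertex.rescale (sq ^ (j - i) * p ^ r₂) (QVertex.seriesU (N := N) q p sq i j r₁))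
            (QVertex.deltaTwoOne (q ^ (j - i) * p ^ r₂))) := by
  open QVertex in
  obtain rfl : r₁ = -r₂ := by omega
  have hsp0 : sp ≠ 0 := by rintro rfl; exact hp (by simp [← hsp])
  have hji : j - i ≠ 0 := fun h => hij (by rw [sub_eq_zero.1 h])
  have h_zpow : ∀ n : ℤ, n ≠ 0 → q ^ n ≠ 1 := by
    intro n hn h
    rcases Int.natAbs_eq n with h' | h'
    · rw [h', zpow_natCast] at h
      exact hq_generic _ (by omega) h
    · rw [h', zpow_neg, inv_eq_one, zpow_natCast] at h
      exact hq_generic _ (by omega) h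
  have hP : p ^ r₂ ≠ 0 := zpow_ne_zero _ hp
  have ht : q ^ (j - i) ≠ 0 := zpow_ne_zero _ hq
  -- The representatives `i` and `j` differ, so `q^{2(j-i)} ≠ 1`.
  have htt : q ^ (j - i) - (q ^ (j - i))⁻¹ ≠ 0 := by
    rw [sub_ne_zero, ← zpow_neg]
    intro h
    refine h_zpow ((j - i) + (j - i)) (by omega) ?_
    nth_rewrite 1 [zpow_add₀ hq, h]
    rw [← zpow_add₀ hq, neg_add_cancel, zpow_zero]
  have hw : (sq ^ (j - i)) ^ 2 = q ^ (j - i) := by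
    rw [← hsq, ← zpow_natCast, ← zpow_natCast, ← zpow_mul, ← zpow_mul, mul_comm]
  funext a b
  refine Finsupp.lhom_ext fun γ s => ?_
  rw [QVertex.commutator, LinearMap.sub_apply, Module.End.mul_apply, Module.End.mul_apply,
    vertexX_vertexX_single hε q hp hsp0 hij rfl,
    vertexX_vertexX_single hε q hp hsp0 hij.symm (neg_neg r₂).symm, root_swap N i j,
    AddSubgroup.coe_neg, form_neg_left, Pi.smul_apply, Pi.smul_apply, Pi.sub_apply, Pi.sub_apply,
    mulOne_deltaOneTwo, mulTwo_deltaTwoOne, LinearMap.smul_apply, LinearMap.sub_apply,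
    LinearMap.smul_apply, LinearMap.smul_apply, rescale, rescale, LinearMap.smul_apply,
    LinearMap.smul_apply, seriesV_single, seriesU_single, ← neg_sub j i, zpow_neg q (j - i),
    zpow_neg p]
  have key := fock_commutator N q p hij r₂ rfl rfl hP ht htt hw s
    (a - form (root N i j : P N) (γ : P N)) (b + form (root N i j : P N) (γ : P N))
  generalize form (root N i j : P N) (γ : P N) = x at *
  rw [show a - x + (b + x) = a + b by ring] at key
  simp only [Finsupp.smul_single, ← Finsupp.single_sub]
  congr 1
  rw [sub_neg_eq_add, sub_neg_eq_add, ← sub_eq_add_neg a x]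
  generalize q ^ (j - i) = t at *
  generalize p ^ r₂ = R at *
  generalize sq ^ (j - i) = w at *
  have e₁ : -R ^ (1 - x) = -R ^ (-x) * R := by
    rw [sub_eq_neg_add, zpow_add_one₀ hP, neg_mul]
  have e₂ : -R⁻¹ ^ (1 + x) = -R ^ (-x) * R⁻¹ := by
    rw [inv_zpow, ← zpow_neg, neg_add_rev, ← sub_eq_add_neg, zpow_sub_one₀ hP, neg_mul]
  -- Coefficients of `u`: on `e^γ` the zero modes give
  -- `(P z₂ / z₁)^{-x} = t^x` at `z₁ = t P z₂`.
  have e₃ : R ^ (-x) * ((R * t) ^ (-(a - x)) * (w * R) ^ (a + b)) =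
      (t * R) ^ (-a) * ((w * R) ^ (a + b) * t ^ x) := by
    rw [neg_sub, sub_eq_add_neg, zpow_add₀ (mul_ne_zero hP ht), mul_zpow R t x, zpow_neg R,
      mul_comm t R]
    have := zpow_ne_zero x hP
    generalize (R * t) ^ (-a) = A
    generalize (w * R) ^ (a + b) = B
    field_simp
  -- Coefficients of `v`: on `e^γ` the zero modes give
  -- `(P z₂ / z₁)^{-x} = t^{-x}` at `z₁ = P t⁻¹ z₂`.
  have e₄ : R ^ (-x) * ((R * t⁻¹) ^ (-(a - x)) * (w * (R * t⁻¹)) ^ (a + b)) =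
      (t * R⁻¹) ^ (-b) * (w ^ (a + b) * t ^ (-x)) := by
    have e : (t * R⁻¹) ^ (-b) = (R * t⁻¹) ^ b := by
      rw [zpow_neg, ← inv_zpow, mul_inv, inv_inv, mul_comm]
    have hRt := mul_ne_zero hP (inv_ne_zero ht)
    rw [e, mul_zpow w, neg_sub, sub_eq_add_neg, zpow_add₀ hRt, zpow_add₀ hRt a b, zpow_neg _ a,
      mul_zpow R t⁻¹ x, zpow_neg R, inv_zpow, zpow_neg t]
    have h₁ := zpow_ne_zero a hRt
    have h₂ := zpow_ne_zero x hP
    have h₃ := zpow_ne_zero x ht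
    generalize (R * t⁻¹) ^ a = A at *
    generalize (R * t⁻¹) ^ b = B at *
    field_simp
  rw [e₁, e₂, mul_smul, mul_smul, ← smul_sub, key]
  simp only [smul_smul]
  rw [← e₄, ← e₃]
  module
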